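/- Let $\mathbb E^4_1$ be Minkowski 4-space with metric $\langle\cdot,\cdot\rangle$ of signature $(+,+,+,-)$, and let $\varepsilon=\pm1$. Let $\lambda(u,v)$, $\mu(u,v)$, $\nu(u,v)$ be smooth functions on a domain (non-empty connected open set) $\mathcal D\subset\mathbb R^2$ satisfying $$\mu\neq 0 \text{ everywhere},\qquad \nu\neq \mathrm{const},$$ $$\nu_u=\lambda_v-\lambda(\ln|\mu|)_v,\qquad \nu_v=\lambda_u-\lambda(\ln|\mu|)_u,\qquad \varepsilon(\nu^2-\lambda^2+\mu^2)=\tfrac12|\mu|\,\Delta\ln|\mu|,$$ where $\Delta=\partial_u^2+\partial_v^2$. Let $q_0\in\mathcal D$ be a point with $\nu(q_0)\neq0$, let $p_0\in\mathbb E^4_1$, and let $\{x_0,y_0,b_0,l_0\}$ be an orthonormal frame at $p_0$ with $\langle x_0,x_0\rangle=\langle y_0,y_0\rangle=1$, $\langle b_0,b_0\rangle=\varepsilon$, $\langle l_0,l_0\rangle=-\varepsilon$. Then there exist a subdomain $\mathcal D_0\subset\mathcal D$ containing $q_0$ and a spacelike surface $M^2: z=z(u,v)$, $(u,v)\in\mathcal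 D_0$, with parallel normalized mean curvature vector field, such that $z(q_0)=p_0$, $\{x_0,y_0,b_0,l_0\}$ is the geometric frame of $M^2$ at $q_0$, the functions $\lambda,\mu,\nu$ are the geometric functions of $M^2$ on $\mathcal D_0$, and $(u,v)$ are canonical parameters of $M^2$. The mean curvature vector of $M^2$ is at every point spacelike if $\varepsilon=1$ and timelike if $\varepsilon=-1$. Moreover $M^2$ is unique: any spacelike surface on $\mathcal D_0$ with parallel normalized mean curvature vector field, for which $(u,v)$ are canonical parameters and which has the same initial point and frame at $q_0$ and the same geometric functions $\lambda,\mu,\nu$, coincides with $z$ on $\mathcal D_0$. Here $E,F,G$ are the coefficients of the first fundamental form of $z$, $\sigma$ is its second fundamental form and $H=\frac12\operatorname{tr}\sigma$. The surface has parallel normalized mean curvature vector field if $H$ is nowhere zero and there is a unit normal field in the direction of $H$ that is parallel in the normal bundle. A geometric frame field $\{x,y,b,l\}$ is an orthonormal frame field, with $\langle b,b\rangle=\varepsilon$, $\langle l,l\rangle=-\varepsilon$ and $b,l$ smooth, such that $x=z_u/\sqrt E$ and $y=z_v/\sqrt G$ are principal (they are orthogonal, and $\sigma(x,x)$, $\sigma(y,y)$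 are collinear) and $b$ is collinear with $H$. The geometric functions are $\lambda,\mu,\nu$ if $\sigma(x,x)=\sigma(y,y)=\nu b$ and $\sigma(x,y)=\lambda b+\mu l$. The parameters are canonical if $E=G=1/|\mu|$ and $F=0$. -/

import Mathlib

open scoped ContDiff

noncomputable section

namespace Minkowski

/-- The underlying space of the Minkowski 4-space `E⁴₁`. -/
abbrev E41 : Type := Fin 4 → ℝ

/-- The flat metric of `E⁴₁`, of signature `(+,+,+,-)`. -/
def inn (x y : E41) : ℝ := x 0 * y 0 + x 1 * y 1 + x 2 * y 2 - x 3 * y 3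

/-- `{x, y, b, l}` is an orthonormal frame with `x, y` spacelike,
`⟨b, b⟩ = ε` and `⟨l, l⟩ = -ε`. -/
structure IsOrthonormalFrame (ε : ℝ) (x y b l : E41) : Prop where
  xx : inn x x = 1
  yy : inn y y = 1
  bb : inn b b = ε
  ll : inn l l = -ε
  xy : inn x y = 0
  xb : inn x b = 0
  xl : inn x l = 0
  yb : inn y b = 0
  yl : inn y l = 0
  bl : inn b l = 0

section Calculus

variable {F : Type*} [NormedAddCommGroup F] [NormedSpace ℝ F]

/-- The derivative of `f` at `p` in the direction `a` of the parameter plane. -/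
def dirDeriv (a : ℝ × ℝ) (f : ℝ × ℝ → F) (p : ℝ × ℝ) : F := fderiv ℝ f p a

/-- The partial derivative `f_u`. -/
def du (f : ℝ × ℝ → F) : ℝ × ℝ → F := dirDeriv (1, 0) f

/-- The partial derivative `f_v`. -/
def dv (f : ℝ × ℝ → F) : ℝ × ℝ → F := dirDeriv (0, 1) f

/-- The Laplace operator `∂²/∂u² + ∂²/∂v²`. -/
def lap (f : ℝ × ℝ → F) (p : ℝ × ℝ) : F := du (du f) p + dv (dv f) p

end Calculus

/-- `z = z(u, v)`, `(u, v) ∈ D`, is a (smooth, regular) spacelike surface in `E⁴₁`: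
the induced metric is positive definite. -/
structure IsSpacelikeSurface (z : ℝ × ℝ → E41) (D : Set (ℝ × ℝ)) : Prop where
  smooth : ContDiffOn ℝ ∞ z D
  spacelike : ∀ p ∈ D, ∀ a : ℝ × ℝ, a ≠ 0 → 0 < inn (dirDeriv a z p) (dirDeriv a z p)

/-! Coefficients of the first fundamental form. -/

def coefE (z : ℝ × ℝ → E41) (p : ℝ × ℝ) : ℝ := inn (du z p) (du z p)

def coefF (z : ℝ × ℝ → E41) (p : ℝ × ℝ) : ℝ := inn (du z p) (dv z p)

def coefG (z : ℝ × ℝ → E41) (p : ℝ × ℝ) : ℝ := inn (dv z p) (dv z p)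

/-- The component of `w` normal to the surface `z` at the parameter point `p`
(with respect to the metric of `E⁴₁`): `w` minus its orthogonal projection
to the span of `z_u` and `z_v`. -/
def normalPart (z : ℝ × ℝ → E41) (p : ℝ × ℝ) (w : E41) : E41 :=
  w - ((inn w (du z p) * coefG z p - inn w (dv z p) * coefF z p) /
        (coefE z p * coefG z p - coefF z p ^ 2)) • du z p
    - ((inn w (dv z p) * coefE z p - inn w (du z p) * coefF z p) /
        (coefE z p * coefG z p - coefF z p ^ 2)) • dv z p

/-- The second fundamental form `σ(dz(a), dz(c))`: the normal component of the flat
derivative in the direction `dz(a)` of the tangent field `dz(c)`. -/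
def secondFF (z : ℝ × ℝ → E41) (p a c : ℝ × ℝ) : E41 :=
  normalPart z p (dirDeriv a (dirDeriv c z) p)

/-- The mean curvature vector `H = (1/2) tr σ`, the trace being taken with respect to the
induced metric. -/
def meanCurv (z : ℝ × ℝ → E41) (p : ℝ × ℝ) : E41 :=
  (1 / (2 * (coefE z p * coefG z p - coefF z p ^ 2))) •
    (coefG z p • secondFF z p (1, 0) (1, 0)
      - (2 * coefF z p) • secondFF z p (1, 0) (0, 1)
      + coefE z p • secondFF z p (0, 1) (0, 1))

/-- The normal field `ξ` along `z` is parallel in the normal bundle on `D`. -/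
structure IsParallelNormal (z ξ : ℝ × ℝ → E41) (D : Set (ℝ × ℝ)) : Prop where
  smooth : ContDiffOn ℝ ∞ ξ D
  normal : ∀ p ∈ D, inn (ξ p) (du z p) = 0 ∧ inn (ξ p) (dv z p) = 0
  parallel : ∀ p ∈ D, ∀ a : ℝ × ℝ, normalPart z p (dirDeriv a ξ p) = 0

/-- The mean curvature vector field is nowhere zero and there is a unit normal field in its
direction which is parallel in the normal bundle. -/
def HasParallelNormalizedMeanCurv (z : ℝ × ℝ → E41) (D : Set (ℝ × ℝ)) : Prop :=
  (∀ p ∈ D, meanCurv z p ≠ 0) ∧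
  ∃ ξ : ℝ × ℝ → E41, IsParallelNormal z ξ D ∧
    (∀ p ∈ D, |inn (ξ p) (ξ p)| = 1) ∧
    (∀ p ∈ D, ∃ h : ℝ, 0 < h ∧ meanCurv z p = h • ξ p)

/-- The parameter direction `a` with `dz(a) = z_u / √E`. -/
def xDir (z : ℝ × ℝ → E41) (p : ℝ × ℝ) : ℝ × ℝ := ((Real.sqrt (coefE z p))⁻¹, 0)

/-- The parameter direction `a` with `dz(a) = z_v / √G`. -/
def yDir (z : ℝ × ℝ → E41) (p : ℝ × ℝ) : ℝ × ℝ := (0, (Real.sqrt (coefG z p))⁻¹)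

/-- `{x, y, b, l}` is the geometric frame field of the surface `z` parametrized by principal
lines: `x = z_u/√E` and `y = z_v/√G` are orthogonal and principal (that is, `σ(x,x)` and
`σ(y,y)` are collinear), and `b` is a unit normal field collinear with the mean curvature
vector; `ε` is the sign of `⟨b, b⟩`. -/
structure IsGeometricFrame (ε : ℝ) (z : ℝ × ℝ → E41) (D : Set (ℝ × ℝ))
    (x y b l : ℝ × ℝ → E41) : Prop where
  smooth_b : ContDiffOn ℝ ∞ b D
  smooth_l : ContDiffOn ℝ ∞ l D
  orthonormal : ∀ p ∈ D, IsOrthonormalFrame ε (x p) (y p) (b p) (l p)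
  x_eq : ∀ p ∈ D, x p = dirDeriv (xDir z p) z p
  y_eq : ∀ p ∈ D, y p = dirDeriv (yDir z p) z p
  principal : ∀ p ∈ D, ¬ LinearIndependent ℝ
    ![secondFF z p (xDir z p) (xDir z p), secondFF z p (yDir z p) (yDir z p)]
  b_dir : ∀ p ∈ D, ∃ h : ℝ, meanCurv z p = h • b p

/-- `ν₁, ν₂, λ, μ` are the coefficients of the second fundamental form in the frame
`{x, y, b, l}`, where `x = z_u/√E` and `y = z_v/√G`:
`σ(x,x) = ν₁ b`, `σ(y,y) = ν₂ b`, `σ(x,y) = λ b + μ l`. -/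
structure HasGeometricFunctions (z : ℝ × ℝ → E41) (D : Set (ℝ × ℝ))
    (b l : ℝ × ℝ → E41) (nu₁ nu₂ lam mu : ℝ × ℝ → ℝ) : Prop where
  xx : ∀ p ∈ D, secondFF z p (xDir z p) (xDir z p) = nu₁ p • b p
  yy : ∀ p ∈ D, secondFF z p (yDir z p) (yDir z p) = nu₂ p • b p
  xy : ∀ p ∈ D, secondFF z p (xDir z p) (yDir z p) = lam p • b p + mu p • l p

/-- The parameters `(u, v)` of `z` are canonical, `μ` being the geometric function `μ`. -/
def IsCanonical (z : ℝ × ℝ → E41) (D : Set (ℝ × ℝ)) (mu : ℝ × ℝ → ℝ) : Prop :=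
  ∀ p ∈ D, coefE z p = 1 / |mu p| ∧ coefF z p = 0 ∧ coefG z p = 1 / |mu p|

/-- `z` is a spacelike surface on `D` with parallel normalized mean curvature vector field,
passing through `p₀` at the parameter point `q₀`, whose geometric frame there is
`{x₀, y₀, b₀, l₀}` and whose geometric functions are `λ, μ, ν` (with `ν = ν₁ = ν₂`). -/
structure IsSurfaceWithData (ε : ℝ) (lam mu nu : ℝ × ℝ → ℝ) (D : Set (ℝ × ℝ)) (q₀ : ℝ × ℝ)
    (p₀ x₀ y₀ b₀ l₀ : E41) (z : ℝ × ℝ → E41) : Prop where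
  surface : IsSpacelikeSurface z D
  pnmc : HasParallelNormalizedMeanCurv z D
  passes : z q₀ = p₀
  frame : ∃ x y b l : ℝ × ℝ → E41,
    IsGeometricFrame ε z D x y b l ∧
    HasGeometricFunctions z D b l nu nu lam mu ∧
    x q₀ = x₀ ∧ y q₀ = y₀ ∧ b q₀ = b₀ ∧ l q₀ = l₀

end Minkowski

end

/-! In canonical parameters put `k = 1/√|μ|`, so that `z_u = k x` and `z_v = k y`. The Gauss and
Weingarten formulas then express all first derivatives of `(z, x, y, b, l)` linearly through the
tuple itself, with coefficients built from `k`, the derivatives of `ln|μ|`, and `λk, μk, νk`.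
Prescribing the geometric functions therefore means solving a linear total differential system `X_u
= A X`, `X_v = B X` with given initial value.

Existence: the integrability condition `A_v + A B = B_u + B A` is exactly the two first-order
equations (Codazzi) and the second-order one (Gauss), see `darboux_compat`; `exists_pfaff_solution`
then gives a local solution. The matrices are skew for `diag(1, 1, ε, -ε)`, so the frame stays
orthonormal (`gram_eq_of_skew`). Reading the system backwards shows that `z` has the required second
fundamental form, `H = ν b`, and a parallel `b` (`isSurfaceWithData_of_darbouxEqs`). Near `q₀` the
function `ν` keeps its sign, so `H` does not vanish and `b` up to that sign is its normalization.

Uniqueness: any competing surface satisfies the same system (`darbouxEqs_of_isGeometricFrame`).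
There the tangential coefficients come from `w_uv = w_vu`, the normal ones from the second
fundamental form, and the derivatives of `b` and `l` from parallelism and orthonormality. A linear
system with equal initial values has one solution, by Grönwall's inequality along rays. -/

noncomputable section

namespace Minkowski

open Set Filter Topology MeasureTheory
open scoped BoundedContinuousFunction NNReal

/-! ### Linear total differential systems in the plane: Frobenius, uniqueness, smoothness. -/

section Pfaff

variable {V : Type*} [NormedAddCommGroup V] [NormedSpace ℝ V]

/-- The differential prescribed at the value `x` by the linear total differential system
`X_u = a X`, `X_v = b X`. -/
def pfaffForm (a b : V →L[ℝ] V) (x : V) : ℝ × ℝ →L[ℝ] V :=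
  (ContinuousLinearMap.toSpanSingleton ℝ (a x)).coprod
    (ContinuousLinearMap.toSpanSingleton ℝ (b x))

lemma pfaffForm_apply (a b : V →L[ℝ] V) (x : V) (w : ℝ × ℝ) :
    pfaffForm a b x w = w.1 • a x + w.2 • b x := by
  simp [pfaffForm]

lemma norm_pfaffForm_apply_le {a b : V →L[ℝ] V} {M : ℝ} (ha : ‖a‖ ≤ M) (hb : ‖b‖ ≤ M)
    (x : V) (w : ℝ × ℝ) : ‖pfaffForm a b x w‖ ≤ 2 * M * ‖w‖ * ‖x‖ := by
  rw [pfaffForm_apply]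
  have h1 : ‖w.1 • a x‖ ≤ ‖w‖ * (M * ‖x‖) := by
    rw [norm_smul]
    exact mul_le_mul (norm_fst_le w) (a.le_of_opNorm_le ha x) (norm_nonneg _) (norm_nonneg _)
  have h2 : ‖w.2 • b x‖ ≤ ‖w‖ * (M * ‖x‖) := by
    rw [norm_smul]
    exact mul_le_mul (norm_snd_le w) (b.le_of_opNorm_le hb x) (norm_nonneg _) (norm_nonneg _)
  calc _ ≤ ‖w.1 • a x‖ + ‖w.2 • b x‖ := norm_add_le _ _
    _ ≤ _ := by linarith

/-- A solution on a ball of a linear total differential system with bounded coefficients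
vanishes if it vanishes at the centre. -/
theorem pfaff_eq_zero {A B : ℝ × ℝ → V →L[ℝ] V} {X : ℝ × ℝ → V} {q₀ : ℝ × ℝ} {r M : ℝ}
    (hA : ∀ q ∈ Metric.ball q₀ r, ‖A q‖ ≤ M) (hB : ∀ q ∈ Metric.ball q₀ r, ‖B q‖ ≤ M)
    (hX : ∀ q ∈ Metric.ball q₀ r, HasFDerivAt X (pfaffForm (A q) (B q) (X q)) q)
    (h0 : X q₀ = 0) : ∀ q ∈ Metric.ball q₀ r, X q = 0 := by
  intro q hq
  have hr : 0 < r := Metric.pos_of_mem_ball hq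
  have hmem : ∀ t ∈ Icc (0 : ℝ) 1, q₀ + t • (q - q₀) ∈ Metric.ball q₀ r := by
    intro t ht
    have := (convex_ball q₀ r).add_smul_sub_mem (Metric.mem_ball_self hr) hq ht
    exact this
  have hd : ∀ t ∈ Icc (0 : ℝ) 1, HasDerivAt (fun t : ℝ => X (q₀ + t • (q - q₀)))
      (pfaffForm (A (q₀ + t • (q - q₀))) (B (q₀ + t • (q - q₀))) (X (q₀ + t • (q - q₀)))
        (q - q₀)) t := by
    intro t ht
    have h1 : HasDerivAt (fun t : ℝ => q₀ + t • (q - q₀)) (q - q₀) t := by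
      simpa using ((hasDerivAt_id t).smul_const (q - q₀)).const_add q₀
    exact (hX _ (hmem t ht)).comp_hasDerivAt t h1
  -- Grönwall on the segment from `q₀` to `q`, with the rate supplied by `norm_pfaffForm_apply_le`.
  have := eq_zero_of_abs_deriv_le_mul_abs_self_of_eq_zero_right
    (f := fun t : ℝ => X (q₀ + t • (q - q₀))) (K := 2 * M * ‖q - q₀‖) (a := 0) (b := 1)
    (fun t ht => (hd t ht).continuousAt.continuousWithinAt)
    (fun t ht => (hd t (Ico_subset_Icc_self ht)).hasDerivWithinAt) (by simpa using h0)
    (fun t ht => norm_pfaffForm_apply_le (hA _ (hmem t (Ico_subset_Icc_self ht)))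
      (hB _ (hmem t (Ico_subset_Icc_self ht))) _ _) 1 (by simp)
  simpa using this

/-- Solutions of a linear total differential system with smooth coefficients are smooth. -/
theorem pfaff_contDiffOn {A B : ℝ × ℝ → V →L[ℝ] V} {X : ℝ × ℝ → V} {U : Set (ℝ × ℝ)}
    (hU : IsOpen U) (hA : ContDiffOn ℝ ∞ A U) (hB : ContDiffOn ℝ ∞ B U)
    (hX : ∀ q ∈ U, HasFDerivAt X (pfaffForm (A q) (B q) (X q)) q) :
    ContDiffOn ℝ ∞ X U := by
  rw [contDiffOn_infty]
  intro n
  induction n with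
  | zero =>
    rw [Nat.cast_zero]
    exact contDiffOn_zero.2 fun q hq => (hX q hq).continuousAt.continuousWithinAt
  | succ n ih =>
    rw [Nat.cast_succ, contDiffOn_succ_iff_fderiv_of_isOpen hU]
    refine ⟨fun q hq => (hX q hq).differentiableAt.differentiableWithinAt, by simp, ?_⟩
    -- Bootstrap: the derivative is a smooth linear expression in `X`, so it is as regular as `X`,
    -- which gains one order.
    have hA' : ContDiffOn ℝ n (fun q => A q (X q)) U :=
      (hA.of_le (mod_cast le_top)).clm_apply ih
    have hB' : ContDiffOn ℝ n (fun q => B q (X q)) U :=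
      (hB.of_le (mod_cast le_top)).clm_apply ih
    have h : ContDiffOn ℝ n (fun q => pfaffForm (A q) (B q) (X q)) U := by
      have e : (fun q => pfaffForm (A q) (B q) (X q)) = fun q =>
          (ContinuousLinearMap.fst ℝ ℝ ℝ).smulRight (A q (X q)) +
            (ContinuousLinearMap.snd ℝ ℝ ℝ).smulRight (B q (X q)) := by
        funext q; ext <;> simp [pfaffForm]
      rw [e]
      exact (contDiffOn_const.smulRight hA').add (contDiffOn_const.smulRight hB')
    exact h.congr fun q hq => (hX q hq).fderiv

/-- Picard iteration for the solution transported first along the line `v = v₀` and then vertically.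
The limits `c`, `d` stay within `r` of the base point, so each integral has Lipschitz constant at
most `r * M ≤ 1 / 4` and their sum contracts by `1 / 2`. Letting `c`, `d` be clamping functions
makes the operator act on bounded continuous functions on the whole plane. -/
lemma exists_pfaff_fixedPoint [CompleteSpace V] {A B : ℝ × ℝ → V →L[ℝ] V} (hA : Continuous A)
    (hB : Continuous B) {r M : ℝ} (hAM : ∀ q, ‖A q‖ ≤ M) (hBM : ∀ q, ‖B q‖ ≤ M)
    (hrM : r * M ≤ 1 / 4) {u₀ v₀ : ℝ} {c d : ℝ → ℝ} (hc : Continuous c) (hd : Continuous d)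
    (hcr : ∀ u, |c u - u₀| ≤ r) (hdr : ∀ v, |d v - v₀| ≤ r) (P : V) :
    ∃ X : ℝ × ℝ →ᵇ V, ∀ u v, X (u, v) = P + (∫ s in u₀..c u, A (s, v₀) (X (s, v₀))) +
      ∫ t in v₀..d v, B (u, t) (X (u, t)) := by
  have hM : 0 ≤ M := (norm_nonneg _).trans (hAM (0, 0))
  have hr : 0 ≤ r := (abs_nonneg _).trans (hcr 0)
  have bd : ∀ (C : ℝ × ℝ → V →L[ℝ] V) (g : ℝ → ℝ × ℝ) (Y : ℝ × ℝ → V) (N a b : ℝ),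
      (∀ q, ‖C q‖ ≤ M) → (∀ q, ‖Y q‖ ≤ N) → |b - a| ≤ r →
      ‖∫ s in a..b, C (g s) (Y (g s))‖ ≤ 1 / 4 * N := by
    intro C g Y N a b hC hY hab
    have hN : 0 ≤ N := (norm_nonneg _).trans (hY (0, 0))
    have := intervalIntegral.norm_integral_le_of_norm_le_const (a := a) (b := b)
      (f := fun s => C (g s) (Y (g s))) (C := M * N) (fun s _ =>
      ((C (g s)).le_of_opNorm_le (hC _) _).trans (mul_le_mul_of_nonneg_left (hY _) hM))
    calc _ ≤ M * N * |b - a| := this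
      _ ≤ M * N * r := by gcongr
      _ = (r * M) * N := by ring
      _ ≤ _ := by gcongr
  let T0 : (ℝ × ℝ →ᵇ V) → ℝ × ℝ → V := fun X q =>
    P + (∫ s in u₀..c q.1, A (s, v₀) (X (s, v₀))) + ∫ t in v₀..d q.2, B (q.1, t) (X (q.1, t))
  have hT0 : ∀ X, Continuous (T0 X) := by
    intro X
    have hX := X.continuous
    refine (continuous_const.add ?_).add ?_
    · exact intervalIntegral.continuous_parametric_intervalIntegral_of_continuous
        (by unfold Function.uncurry; fun_prop) (by fun_prop)
    · exact intervalIntegral.continuous_parametric_intervalIntegral_of_continuous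
        (by unfold Function.uncurry; fun_prop) (by fun_prop)
  have hT0b : ∀ (X : ℝ × ℝ →ᵇ V) q, ‖T0 X q‖ ≤ ‖P‖ + 1 / 4 * ‖X‖ + 1 / 4 * ‖X‖ := by
    intro X q
    refine (norm_add_le _ _).trans (add_le_add ((norm_add_le _ _).trans (add_le_add le_rfl ?_)) ?_)
    · exact bd A (fun s => (s, v₀)) X _ _ _ hAM X.norm_coe_le_norm (hcr _)
    · exact bd B (fun t => (q.1, t)) X _ _ _ hBM X.norm_coe_le_norm (hdr _)
  let T : (ℝ × ℝ →ᵇ V) → (ℝ × ℝ →ᵇ V) := fun X =>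
    BoundedContinuousFunction.ofNormedAddCommGroup (T0 X) (hT0 X) _ (hT0b X)
  have hT : ContractingWith (1 / 2) T := by
    refine ⟨by norm_num, LipschitzWith.of_dist_le_mul fun X Y => ?_⟩
    rw [BoundedContinuousFunction.dist_le (by positivity)]
    intro q
    rw [dist_eq_norm]
    have e : T X q - T Y q = (∫ s in u₀..c q.1, A (s, v₀) ((X - Y) (s, v₀))) +
        ∫ t in v₀..d q.2, B (q.1, t) ((X - Y) (q.1, t)) := by
      have hX := X.continuous
      have hY := Y.continuous
      simp only [BoundedContinuousFunction.coe_sub, Pi.sub_apply, map_sub]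
      rw [intervalIntegral.integral_sub, intervalIntegral.integral_sub]
      · simp only [T, T0, BoundedContinuousFunction.coe_ofNormedAddCommGroup]
        abel
      all_goals
        apply Continuous.intervalIntegrable
        fun_prop
    have n : ∀ q, ‖(X - Y) q‖ ≤ dist X Y := by
      intro q; rw [dist_eq_norm]; exact (X - Y).norm_coe_le_norm q
    rw [e]
    refine (norm_add_le _ _).trans ?_
    have h1 := bd A (fun s => (s, v₀)) (⇑(X - Y)) _ _ _ hAM n (hcr q.1)
    have h2 := bd B (fun t => (q.1, t)) (⇑(X - Y)) _ _ _ hBM n (hdr q.2)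
    simp only [NNReal.coe_div, NNReal.coe_one, NNReal.coe_ofNat]
    linarith
  refine ⟨hT.fixedPoint, fun u v => ?_⟩
  conv_lhs => rw [← hT.fixedPoint_isFixedPt]
  rfl


lemma hasDerivAt_slice_fst {f : ℝ × ℝ → V} {u v : ℝ} (hf : DifferentiableAt ℝ f (u, v)) :
    HasDerivAt (fun s => f (s, v)) (du f (u, v)) u :=
  hf.hasFDerivAt.comp_hasDerivAt u ((hasDerivAt_id u).prodMk (hasDerivAt_const u v))

lemma hasDerivAt_slice_snd {f : ℝ × ℝ → V} {u v : ℝ} (hf : DifferentiableAt ℝ f (u, v)) :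
    HasDerivAt (fun t => f (u, t)) (dv f (u, v)) v :=
  hf.hasFDerivAt.comp_hasDerivAt v ((hasDerivAt_const v u).prodMk (hasDerivAt_id v))

lemma continuousOn_dirDeriv {f : ℝ × ℝ → V} {U : Set (ℝ × ℝ)} (hU : IsOpen U)
    (hf : ContDiffOn ℝ 1 f U) (a : ℝ × ℝ) : ContinuousOn (dirDeriv a f) U :=
  (hf.continuousOn_fderiv_of_isOpen hU le_rfl).clm_apply continuousOn_const

lemma hasDerivAt_primitive {φ : ℝ → V} [CompleteSpace V] {u₀ r : ℝ}
    (hφ : ContinuousOn φ (Metric.ball u₀ r)) {u : ℝ} (hu : u ∈ Metric.ball u₀ r) :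
    HasDerivAt (fun x => ∫ s in u₀..x, φ s) (φ u) u := by
  have hr : 0 < r := Metric.pos_of_mem_ball hu
  refine intervalIntegral.integral_hasDerivAt_right (ContinuousOn.intervalIntegrable (hφ.mono ?_))
    (hφ.stronglyMeasurableAtFilter Metric.isOpen_ball u hu)
    (hφ.continuousAt (Metric.isOpen_ball.mem_nhds hu))
  rw [← segment_eq_uIcc]
  exact (convex_ball u₀ r).segment_subset (Metric.mem_ball_self hr) hu

/-- The core of Frobenius' theorem: the `u`-equation, known only on `v = v₀`, spreads along the
`v`-flow. The defect `W` of its integrated form vanishes on that line, and compatibility gives it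
the homogeneous equation `W_v = B W - ∫ B_u W`, which forces it to vanish. -/
lemma pfaff_hasDerivAt_fst [CompleteSpace V] {A B : ℝ × ℝ → V →L[ℝ] V} {u₀ v₀ r M N : ℝ}
    (hr1 : r ≤ 1) (hrM : r * M ≤ 1 / 4)
    (hA : ContDiffOn ℝ 1 A (Metric.ball (u₀, v₀) r))
    (hB : ContDiffOn ℝ 1 B (Metric.ball (u₀, v₀) r))
    (hAM : ∀ q ∈ Metric.ball (u₀, v₀) r, ‖A q‖ ≤ M)
    (hBM : ∀ q ∈ Metric.ball (u₀, v₀) r, ‖B q‖ ≤ M)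
    (hAvM : ∀ q ∈ Metric.ball (u₀, v₀) r, ‖dv A q‖ ≤ M)
    (hBuM : ∀ q ∈ Metric.ball (u₀, v₀) r, ‖du B q‖ ≤ M)
    (hcomp : ∀ q ∈ Metric.ball (u₀, v₀) r, ∀ x,
      dv A q x + A q (B q x) = du B q x + B q (A q x))
    {X : ℝ × ℝ → V} (hX : Continuous X) (hXN : ∀ q, ‖X q‖ ≤ N)
    (hXv : ∀ q ∈ Metric.ball (u₀, v₀) r, HasDerivAt (fun t => X (q.1, t)) (B q (X q)) q.2)
    (hXu : ∀ u ∈ Metric.ball u₀ r, HasDerivAt (fun s => X (s, v₀)) (A (u, v₀) (X (u, v₀))) u) :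
    ∀ q ∈ Metric.ball (u₀, v₀) r, HasDerivAt (fun s => X (s, q.2)) (A q (X q)) q.1 := by
  rintro ⟨u', v'⟩ hq'
  have hr : 0 < r := Metric.pos_of_mem_ball hq'
  -- The product carries the sup metric, so the ball is a product of two intervals.
  rw [← ball_prod_same] at *
  set I := Metric.ball u₀ r with hI
  set J := Metric.ball v₀ r with hJ
  have hIJ : IsOpen (I ×ˢ J) := Metric.isOpen_ball.prod Metric.isOpen_ball
  have hu₀ : u₀ ∈ I := Metric.mem_ball_self hr
  have hv₀ : v₀ ∈ J := Metric.mem_ball_self hr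
  have hM : 0 ≤ M := (norm_nonneg _).trans (hAM _ hq')
  have hN : 0 ≤ N := (norm_nonneg _).trans (hXN 0)
  have hseg : ∀ u ∈ I, uIcc u₀ u ⊆ I := fun u hu => by
    rw [← segment_eq_uIcc]; exact (convex_ball u₀ r).segment_subset hu₀ hu
  have slice : ∀ {f : ℝ × ℝ → V}, ContinuousOn f (I ×ˢ J) → ∀ v ∈ J,
      ContinuousOn (fun s => f (s, v)) I := fun hf v hv =>
    hf.comp (by fun_prop) fun s hs => ⟨hs, hv⟩
  have integ : ∀ {f : ℝ → V}, ContinuousOn f I → ∀ u ∈ I, IntervalIntegrable f volume u₀ u :=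
    fun hf u hu => (hf.mono (hseg u hu)).intervalIntegrable
  have cA : ContinuousOn (fun q => A q (X q)) (I ×ˢ J) := hA.continuousOn.clm_apply hX.continuousOn
  have cBu : ContinuousOn (du B) (I ×ˢ J) := continuousOn_dirDeriv hIJ hB _
  have cAv : ContinuousOn (dv A) (I ×ˢ J) := continuousOn_dirDeriv hIJ hA _
  let Φ : ℝ → ℝ → V := fun u v => ∫ s in u₀..u, A (s, v) (X (s, v))
  let W : ℝ → ℝ → V := fun u v => X (u, v) - X (u₀, v) - Φ u v
  have hΦu : ∀ u ∈ I, ∀ v ∈ J, HasDerivAt (fun x => Φ x v) (A (u, v) (X (u, v))) u :=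
    fun u hu v hv => hasDerivAt_primitive (slice cA v hv) hu
  have hAd : ∀ q ∈ I ×ˢ J, DifferentiableAt ℝ A q := fun q hq =>
    (hA.differentiableOn one_ne_zero).differentiableAt (hIJ.mem_nhds hq)
  have hBd : ∀ q ∈ I ×ˢ J, DifferentiableAt ℝ B q := fun q hq =>
    (hB.differentiableOn one_ne_zero).differentiableAt (hIJ.mem_nhds hq)
  have hΦv : ∀ u ∈ I, ∀ v ∈ J, HasDerivAt (fun t => Φ u t)
      (∫ s in u₀..u, (dv A (s, v) (X (s, v)) + A (s, v) (B (s, v) (X (s, v))))) v := by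
    intro u hu v hv
    refine (intervalIntegral.hasDerivAt_integral_of_dominated_loc_of_deriv_le
      (F := fun t s => A (s, t) (X (s, t)))
      (F' := fun t s => dv A (s, t) (X (s, t)) + A (s, t) (B (s, t) (X (s, t))))
      (bound := fun _ => M * N + M * (M * N)) (s := J)
      (Metric.isOpen_ball.mem_nhds hv) ?_ ?_ ?_ ?_ ?_ ?_).2
    · filter_upwards [Metric.isOpen_ball.mem_nhds hv] with t ht
      exact (integ (slice cA t ht) u hu).def'.aestronglyMeasurable
    · exact integ (slice cA v hv) u hu
    · refine (integ (f := fun s => dv A (s, v) (X (s, v)) + A (s, v) (B (s, v) (X (s, v))))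
        (slice (f := fun q => dv A q (X q) + A q (B q (X q))) ?_ v hv) u hu).def'.aestronglyMeasurable
      exact (cAv.clm_apply hX.continuousOn).add
        (hA.continuousOn.clm_apply (hB.continuousOn.clm_apply hX.continuousOn))
    · refine ae_of_all _ fun s hs t ht => ?_
      have hst : (s, t) ∈ I ×ˢ J := ⟨hseg u hu (uIoc_subset_uIcc hs), ht⟩
      refine (norm_add_le _ _).trans (add_le_add ?_ ?_)
      · exact ((dv A (s, t)).le_of_opNorm_le (hAvM _ hst) _).trans
          (mul_le_mul_of_nonneg_left (hXN _) hM)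
      · exact ((A (s, t)).le_of_opNorm_le (hAM _ hst) _).trans (mul_le_mul_of_nonneg_left
          (((B (s, t)).le_of_opNorm_le (hBM _ hst) _).trans
            (mul_le_mul_of_nonneg_left (hXN _) hM)) hM)
    · exact intervalIntegrable_const
    · refine ae_of_all _ fun s hs t ht => ?_
      have hst : (s, t) ∈ I ×ˢ J := ⟨hseg u hu (uIoc_subset_uIcc hs), ht⟩
      exact (hasDerivAt_slice_snd (hAd _ hst)).clm_apply (hXv _ hst)
  have hWv : ∀ u ∈ I, ∀ v ∈ J, HasDerivAt (fun t => W u t)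
      (B (u, v) (W u v) - ∫ s in u₀..u, du B (s, v) (W s v)) v := by
    intro u hu v hv
    have h1 := ((hXv (u, v) ⟨hu, hv⟩).sub (hXv (u₀, v) ⟨hu₀, hv⟩)).sub (hΦv u hu v hv)
    refine HasDerivAt.congr_deriv h1 ?_
    -- Integration by parts: `X (u₀, v) + Φ s v` has `s`-derivative `A X`, and differentiates what
    -- `X` itself would be if the `u`-equation held.
    have h2 : ∫ s in u₀..u, (du B (s, v) (X (u₀, v) + Φ s v) + B (s, v) (A (s, v) (X (s, v))))
        = B (u, v) (X (u₀, v) + Φ u v) - B (u₀, v) (X (u₀, v) + Φ u₀ v) := by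
      refine intervalIntegral.integral_eq_sub_of_hasDerivAt
        (f := fun s => B (s, v) (X (u₀, v) + Φ s v)) (fun s hs => ?_) ?_
      · have hs' := hseg u hu hs
        exact (hasDerivAt_slice_fst (hBd _ ⟨hs', hv⟩)).clm_apply
          ((hΦu s hs' v hv).const_add _)
      · refine integ (ContinuousOn.add ?_ ?_) u hu
        · refine (cBu.comp (f := fun s => (s, v)) (by fun_prop) fun s hs => ⟨hs, hv⟩).clm_apply
            (continuousOn_const.add fun s hs => ?_)
          exact (hΦu s hs v hv).continuousAt.continuousWithinAt
        · exact slice (f := fun q => B q (A q (X q))) (hB.continuousOn.clm_apply cA) v hv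
    have h3 : ∫ s in u₀..u, du B (s, v) (W s v) =
        (∫ s in u₀..u, (dv A (s, v) (X (s, v)) + A (s, v) (B (s, v) (X (s, v))))) -
        ∫ s in u₀..u, (du B (s, v) (X (u₀, v) + Φ s v) + B (s, v) (A (s, v) (X (s, v)))) := by
      rw [← intervalIntegral.integral_sub]
      · refine intervalIntegral.integral_congr fun s hs => ?_
        have := hcomp (s, v) ⟨hseg u hu hs, hv⟩ (X (s, v))
        simp only [W, this, map_sub, map_add]
        abel
      · exact integ (slice (f := fun q => dv A q (X q) + A q (B q (X q)))
          ((cAv.clm_apply hX.continuousOn).add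
          (hA.continuousOn.clm_apply (hB.continuousOn.clm_apply hX.continuousOn))) v hv) u hu
      · refine integ (ContinuousOn.add ?_ ?_) u hu
        · refine (cBu.comp (f := fun s => (s, v)) (by fun_prop) fun s hs => ⟨hs, hv⟩).clm_apply
            (continuousOn_const.add fun s hs => ?_)
          exact (hΦu s hs v hv).continuousAt.continuousWithinAt
        · exact slice (f := fun q => B q (A q (X q))) (hB.continuousOn.clm_apply cA) v hv
    have h4 : Φ u₀ v = 0 := intervalIntegral.integral_same
    rw [h3, h2, h4]
    simp only [W, map_sub, map_add, add_zero]
    abel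
  have hW0 : ∀ u ∈ I, W u v₀ = 0 := by
    intro u hu
    have : Φ u v₀ = X (u, v₀) - X (u₀, v₀) :=
      intervalIntegral.integral_eq_sub_of_hasDerivAt (f := fun s => X (s, v₀))
        (fun s hs => hXu s (hseg u hu hs)) (integ (slice cA v₀ hv₀) u hu)
    simp only [W, this, sub_self]
  have hdist : ∀ u ∈ I, |u - u₀| ≤ r := fun u hu => by
    rw [← Real.dist_eq]; exact (Metric.mem_ball.1 hu).le
  -- Integrating `W_v` from `v₀` turns a bound `S` into `2 * M * S * r ≤ S / 2`; here `r ≤ 1`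
  -- absorbs the length of the inner integral. Iterating from any finite bound gives `W = 0`.
  have step : ∀ S, (∀ u ∈ I, ∀ v ∈ J, ‖W u v‖ ≤ S) → ∀ u ∈ I, ∀ v ∈ J, ‖W u v‖ ≤ S / 2 := by
    intro S hS u hu v hv
    have hS0 : 0 ≤ S := (norm_nonneg _).trans (hS u hu v hv)
    have hb : ∀ t ∈ J, ‖B (u, t) (W u t) - ∫ s in u₀..u, du B (s, t) (W s t)‖ ≤ 2 * (M * S) := by
      intro t ht
      have h1 : ‖B (u, t) (W u t)‖ ≤ M * S :=
        ((B (u, t)).le_of_opNorm_le (hBM _ ⟨hu, ht⟩) _).trans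
          (mul_le_mul_of_nonneg_left (hS u hu t ht) hM)
      have h2 : ‖∫ s in u₀..u, du B (s, t) (W s t)‖ ≤ M * S * |u - u₀| := by
        refine intervalIntegral.norm_integral_le_of_norm_le_const fun s hs => ?_
        have hs' := hseg u hu (uIoc_subset_uIcc hs)
        exact ((du B (s, t)).le_of_opNorm_le (hBuM _ ⟨hs', ht⟩) _).trans
          (mul_le_mul_of_nonneg_left (hS s hs' t ht) hM)
      have h3 : M * S * |u - u₀| ≤ M * S * 1 :=
        mul_le_mul_of_nonneg_left ((hdist u hu).trans hr1) (by positivity)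
      refine (norm_sub_le _ _).trans ?_
      linarith
    have := (convex_ball v₀ r).norm_image_sub_le_of_norm_hasDerivWithin_le
      (fun t ht => (hWv u hu t ht).hasDerivWithinAt) hb hv₀ hv
    rw [hW0 u hu, sub_zero, Real.norm_eq_abs] at this
    calc _ ≤ _ := this
      _ ≤ 2 * (M * S) * r := by
        refine mul_le_mul_of_nonneg_left ?_ (by positivity)
        rw [← Real.dist_eq]; exact (Metric.mem_ball.1 hv).le
      _ = 2 * (r * M) * S := by ring
      _ ≤ 2 * (1 / 4) * S := by gcongr
      _ = S / 2 := by ring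
  have hWb : ∀ u ∈ I, ∀ v ∈ J, ‖W u v‖ ≤ N + N + M * N := by
    intro u hu v hv
    have h2 : ‖Φ u v‖ ≤ M * N * |u - u₀| := by
      refine intervalIntegral.norm_integral_le_of_norm_le_const fun s hs => ?_
      have hs' := hseg u hu (uIoc_subset_uIcc hs)
      exact ((A (s, v)).le_of_opNorm_le (hAM _ ⟨hs', hv⟩) _).trans
        (mul_le_mul_of_nonneg_left (hXN _) hM)
    have h3 : M * N * |u - u₀| ≤ M * N * 1 :=
      mul_le_mul_of_nonneg_left ((hdist u hu).trans hr1) (by positivity)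
    refine (norm_sub_le _ _).trans (add_le_add ((norm_sub_le _ _).trans
      (add_le_add (hXN _) (hXN _))) (by linarith))
  have hWn : ∀ n : ℕ, ∀ u ∈ I, ∀ v ∈ J, ‖W u v‖ ≤ (N + N + M * N) * (1 / 2) ^ n := by
    intro n
    induction n with
    | zero => simpa using hWb
    | succ n ih =>
      have := step _ ih
      intro u hu v hv
      refine (this u hu v hv).trans (le_of_eq ?_)
      ring
  have hWz : ∀ u ∈ I, ∀ v ∈ J, W u v = 0 := by
    intro u hu v hv
    have ht : Tendsto (fun n : ℕ => (N + N + M * N) * (1 / 2 : ℝ) ^ n) atTop (𝓝 0) := by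
      simpa using (tendsto_pow_atTop_nhds_zero_of_lt_one (r := (1 / 2 : ℝ)) (by norm_num)
        (by norm_num)).const_mul (N + N + M * N)
    exact norm_le_zero_iff.1 (ge_of_tendsto' ht fun n => hWn n u hu v hv)
  have := (hΦu u' hq'.1 v' hq'.2).const_add (X (u₀, v'))
  refine this.congr_of_eventuallyEq ?_
  filter_upwards [Metric.isOpen_ball.mem_nhds hq'.1] with s hs
  have h := hWz s hs v' hq'.2
  simp only [W] at h
  rw [sub_sub, sub_eq_zero] at h
  exact h


/-- Frobenius' theorem for linear total differential systems in the plane: the system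
`X_u = A X`, `X_v = B X` is locally solvable if `A_v + A B = B_u + B A`. -/
theorem exists_pfaff_solution [CompleteSpace V] {A B : ℝ × ℝ → V →L[ℝ] V} {U : Set (ℝ × ℝ)}
    (hU : IsOpen U) (hA : ContDiffOn ℝ 1 A U) (hB : ContDiffOn ℝ 1 B U)
    (hcomp : ∀ q ∈ U, ∀ x, dv A q x + A q (B q x) = du B q x + B q (A q x))
    {q₀ : ℝ × ℝ} (hq₀ : q₀ ∈ U) (P : V) :
    ∃ r > 0, ∃ X : ℝ × ℝ → V, X q₀ = P ∧
      ∀ q ∈ Metric.ball q₀ r, HasFDerivAt X (pfaffForm (A q) (B q) (X q)) q := by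
  obtain ⟨u₀, v₀⟩ := q₀
  obtain ⟨R, hR, hRU⟩ := Metric.nhds_basis_closedBall.mem_iff.1 (hU.mem_nhds hq₀)
  have hK : IsCompact (Metric.closedBall (u₀, v₀) R) := isCompact_closedBall _ _
  obtain ⟨M₁, h₁⟩ := hK.exists_bound_of_continuousOn (hA.continuousOn.mono hRU)
  obtain ⟨M₂, h₂⟩ := hK.exists_bound_of_continuousOn (hB.continuousOn.mono hRU)
  obtain ⟨M₃, h₃⟩ := hK.exists_bound_of_continuousOn
    ((continuousOn_dirDeriv hU hA (0, 1)).mono hRU)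
  obtain ⟨M₄, h₄⟩ := hK.exists_bound_of_continuousOn
    ((continuousOn_dirDeriv hU hB (1, 0)).mono hRU)
  obtain ⟨M, hM, hM₁, hM₂, hM₃, hM₄⟩ : ∃ M > 0, M₁ ≤ M ∧ M₂ ≤ M ∧ M₃ ≤ M ∧ M₄ ≤ M :=
    ⟨max 1 (max (max M₁ M₂) (max M₃ M₄)), by positivity, by simp, by simp, by simp, by simp⟩
  -- `R` keeps the ball inside `U`, while `1` and `1 / (4 * M)` are the smallness required by the
  -- fixed point and by the halving of the defect.
  let r := min R (min 1 (1 / (4 * M)))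
  have hr : 0 < r := lt_min hR (lt_min one_pos (by positivity))
  have hrM : r * M ≤ 1 / 4 := by
    have : r ≤ 1 / (4 * M) := (min_le_right _ _).trans (min_le_right _ _)
    calc r * M ≤ 1 / (4 * M) * M := by gcongr
      _ = 1 / 4 := by field_simp
  have hrR : Metric.closedBall (u₀, v₀) r ⊆ Metric.closedBall (u₀, v₀) R :=
    Metric.closedBall_subset_closedBall (min_le_left _ _)
  have hbR : Metric.ball (u₀, v₀) r ⊆ Metric.closedBall (u₀, v₀) R :=
    Metric.ball_subset_closedBall.trans hrR
  have hbU : Metric.ball (u₀, v₀) r ⊆ U := hbR.trans hRU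
  -- Clamping to `[a - r, a + r]` extends the coefficients to bounded continuous functions on the
  -- plane without changing them on the ball.
  let cl : ℝ → ℝ → ℝ := fun a x => max (a - r) (min (a + r) x)
  have hcl : ∀ a, Continuous (cl a) := fun a => by fun_prop
  have hclr : ∀ a x, |cl a x - a| ≤ r := fun a x => by
    have h1 : a - r ≤ cl a x := le_max_left _ _
    have h2 : cl a x ≤ a + r := max_le (by linarith) (min_le_left _ _)
    rw [abs_le]; constructor <;> linarith
  have hcle : ∀ a, ∀ x ∈ Metric.ball a r, cl a x = x := fun a x hx => by
    rw [Metric.mem_ball, Real.dist_eq, abs_lt] at hx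
    simp only [cl]
    rw [min_eq_right (by linarith), max_eq_right (by linarith)]
  let p : ℝ × ℝ → ℝ × ℝ := fun q => (cl u₀ q.1, cl v₀ q.2)
  have hp : Continuous p := by fun_prop
  have hpK : ∀ q, p q ∈ Metric.closedBall (u₀, v₀) R := fun q => hrR <| by
    rw [Metric.mem_closedBall, Prod.dist_eq]
    exact max_le (hclr u₀ q.1) (hclr v₀ q.2)
  have hpe : ∀ q ∈ Metric.ball (u₀, v₀) r, p q = q := fun q hq => by
    rw [← ball_prod_same] at hq
    exact Prod.ext (hcle _ _ hq.1) (hcle _ _ hq.2)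
  have hAp : Continuous (A ∘ p) :=
    hA.continuousOn.comp_continuous hp fun q => hRU (hpK q)
  have hBp : Continuous (B ∘ p) :=
    hB.continuousOn.comp_continuous hp fun q => hRU (hpK q)
  obtain ⟨X, hX⟩ := exists_pfaff_fixedPoint hAp hBp (r := r) (M := M)
    (fun q => (h₁ _ (hpK q)).trans hM₁) (fun q => (h₂ _ (hpK q)).trans hM₂) hrM
    (hcl u₀) (hcl v₀) (hclr u₀) (hclr v₀) P
  have hXc : Continuous X := X.continuous
  have hXv : ∀ q ∈ Metric.ball (u₀, v₀) r,
      HasDerivAt (fun t => X (q.1, t)) (B q (X q)) q.2 := by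
    rintro ⟨u, v⟩ hq
    have hq' := hq
    rw [← ball_prod_same] at hq'
    have hc : Continuous fun t => (B ∘ p) (u, t) (X (u, t)) :=
      (hBp.comp (Continuous.prodMk_right u)).clm_apply (hXc.comp (Continuous.prodMk_right u))
    have h := (hasDerivAt_primitive (u₀ := v₀) (r := r) hc.continuousOn hq'.2).const_add
      (P + ∫ s in u₀..cl u₀ u, (A ∘ p) (s, v₀) (X (s, v₀)))
    simp only [Function.comp_apply, hpe _ hq] at h
    refine h.congr_of_eventuallyEq ?_
    filter_upwards [Metric.isOpen_ball.mem_nhds hq'.2] with t ht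
    rw [hX, hcle _ t ht]
    rfl
  have hXu : ∀ u ∈ Metric.ball u₀ r,
      HasDerivAt (fun s => X (s, v₀)) (A (u, v₀) (X (u, v₀))) u := by
    intro u hu
    have hq : (u, v₀) ∈ Metric.ball (u₀, v₀) r := by
      rw [← ball_prod_same]; exact ⟨hu, Metric.mem_ball_self hr⟩
    have hc : Continuous fun s => (A ∘ p) (s, v₀) (X (s, v₀)) :=
      (hAp.comp (Continuous.prodMk_left v₀)).clm_apply (hXc.comp (Continuous.prodMk_left v₀))
    have h := (hasDerivAt_primitive (u₀ := u₀) (r := r) hc.continuousOn hu).const_add P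
    simp only [Function.comp_apply, hpe _ hq] at h
    refine h.congr_of_eventuallyEq ?_
    filter_upwards [Metric.isOpen_ball.mem_nhds hu] with s hs
    rw [hX, hcle _ s hs, hcle _ v₀ (Metric.mem_ball_self hr)]
    simp
  have hXu' := pfaff_hasDerivAt_fst (A := A) (B := B) ((min_le_right _ _).trans (min_le_left _ _))
    hrM (hA.mono hbU) (hB.mono hbU)
    (fun q hq => (h₁ q (hbR hq)).trans hM₁) (fun q hq => (h₂ q (hbR hq)).trans hM₂)
    (fun q hq => (h₃ q (hbR hq)).trans hM₃) (fun q hq => (h₄ q (hbR hq)).trans hM₄)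
    (fun q hq => hcomp q (hbU hq)) hXc X.norm_coe_le_norm hXv hXu
  refine ⟨r, hr, X, ?_, fun q hq => ?_⟩
  · rw [hX, hcle _ u₀ (Metric.mem_ball_self hr), hcle _ v₀ (Metric.mem_ball_self hr)]
    simp
  · have hnhds : ∀ᶠ q' in 𝓝 q, q' ∈ Metric.ball (u₀, v₀) r := Metric.isOpen_ball.mem_nhds hq
    have hs : ∀ Y : ℝ × ℝ → V, ContinuousAt Y q →
        ContinuousAt (fun q => ContinuousLinearMap.toSpanSingleton ℝ (Y q)) q := fun Y hY =>
      (ContinuousLinearMap.toSpanSingletonCLE (𝕜 := ℝ) (E := V)).continuous.continuousAt.comp hY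
    have hmem : U ∈ 𝓝 q := hU.mem_nhds (hbU hq)
    -- Both partial derivatives exist near `q` and are continuous at `q`, so they assemble into a
    -- total differential.
    have h := hasStrictFDerivAt_uncurry_coprod (𝕜 := ℝ) (u := q) (f := fun a b => X (a, b))
      (f₁ := fun a b => ContinuousLinearMap.toSpanSingleton ℝ (A (a, b) (X (a, b))))
      (f₂ := fun a b => ContinuousLinearMap.toSpanSingleton ℝ (B (a, b) (X (a, b))))
      (hnhds.mono fun q' h' => (hXu' q' h').hasFDerivAt)
      (hnhds.mono fun q' h' => (hXv q' h').hasFDerivAt)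
      (hs (fun q => A q (X q)) ((hA.continuousOn.continuousAt hmem).clm_apply hXc.continuousAt))
      (hs (fun q => B q (X q)) ((hB.continuousOn.continuousAt hmem).clm_apply hXc.continuousAt))
    exact h.hasFDerivAt


/-- Coefficients merely continuous on the open ball may blow up at its boundary; a slightly smaller
closed ball around the centre still contains the given point and supplies bounds by compactness. -/
theorem pfaff_eq_zero_of_continuousOn {A B : ℝ × ℝ → V →L[ℝ] V} {X : ℝ × ℝ → V} {q₀ : ℝ × ℝ}
    {r : ℝ} (hA : ContinuousOn A (Metric.ball q₀ r)) (hB : ContinuousOn B (Metric.ball q₀ r))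
    (hX : ∀ q ∈ Metric.ball q₀ r, HasFDerivAt X (pfaffForm (A q) (B q) (X q)) q)
    (h0 : X q₀ = 0) : ∀ q ∈ Metric.ball q₀ r, X q = 0 := by
  intro q hq
  obtain ⟨ρ, hqρ, hρ⟩ := exists_between (Metric.mem_ball.1 hq)
  have hK : IsCompact (Metric.closedBall q₀ ρ) := isCompact_closedBall _ _
  have hsub : Metric.closedBall q₀ ρ ⊆ Metric.ball q₀ r := Metric.closedBall_subset_ball hρ
  obtain ⟨M₁, h₁⟩ := hK.exists_bound_of_continuousOn (hA.mono hsub)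
  obtain ⟨M₂, h₂⟩ := hK.exists_bound_of_continuousOn (hB.mono hsub)
  exact pfaff_eq_zero (r := ρ) (M := max M₁ M₂)
    (fun p hp => (h₁ p (Metric.ball_subset_closedBall hp)).trans (le_max_left _ _))
    (fun p hp => (h₂ p (Metric.ball_subset_closedBall hp)).trans (le_max_right _ _))
    (fun p hp => hX p (hsub (Metric.ball_subset_closedBall hp))) h0 q hqρ

lemma dirDeriv_eq {f : ℝ × ℝ → V} (p c : ℝ × ℝ) :
    dirDeriv c f p = c.1 • du f p + c.2 • dv f p := by
  have : c = c.1 • ((1, 0) : ℝ × ℝ) + c.2 • ((0, 1) : ℝ × ℝ) := by ext <;> simp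
  conv_lhs => rw [dirDeriv, this, map_add, map_smul, map_smul]
  rfl

lemma hasFDerivAt_pfaffForm_iff {a b : V →L[ℝ] V} {x : V} {f : ℝ × ℝ → V} {q : ℝ × ℝ} :
    HasFDerivAt f (pfaffForm a b x) q ↔
      DifferentiableAt ℝ f q ∧ du f q = a x ∧ dv f q = b x := by
  constructor
  · intro h
    refine ⟨h.differentiableAt, ?_, ?_⟩
    · simp [du, dirDeriv, h.fderiv, pfaffForm_apply]
    · simp [dv, dirDeriv, h.fderiv, pfaffForm_apply]
  · rintro ⟨h, hu, hv⟩
    convert h.hasFDerivAt using 1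
    ext
    · simpa [pfaffForm_apply, du, dirDeriv] using hu.symm
    · simpa [pfaffForm_apply, dv, dirDeriv] using hv.symm

lemma dirDeriv_congr {f g : ℝ × ℝ → V} {p : ℝ × ℝ} (h : f =ᶠ[𝓝 p] g)
    (c : ℝ × ℝ) : dirDeriv c f p = dirDeriv c g p := by
  simp only [dirDeriv, h.fderiv_eq]

lemma dirDeriv_smul {f : ℝ × ℝ → ℝ} {g : ℝ × ℝ → V} {p : ℝ × ℝ} (hf : DifferentiableAt ℝ f p)
    (hg : DifferentiableAt ℝ g p) (c : ℝ × ℝ) :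
    dirDeriv c (fun q => f q • g q) p = f p • dirDeriv c g p + dirDeriv c f p • g p := by
  simp only [dirDeriv]
  rw [fderiv_fun_smul hf hg]
  simp

lemma dirDeriv_pi {ι : Type*} [Fintype ι] {f : ℝ × ℝ → ι → V} {p : ℝ × ℝ}
    (hf : DifferentiableAt ℝ f p) (c : ℝ × ℝ) (i : ι) :
    dirDeriv c (fun q => f q i) p = dirDeriv c f p i := by
  simp only [dirDeriv]
  rw [fderiv_apply hf]
  rfl

lemma dirDeriv_clm {W : Type*} [NormedAddCommGroup W] [NormedSpace ℝ W] (L : V →L[ℝ] W)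
    {f : ℝ × ℝ → V} {p : ℝ × ℝ} (hf : DifferentiableAt ℝ f p) (c : ℝ × ℝ) :
    dirDeriv c (fun q => L (f q)) p = L (dirDeriv c f p) := by
  have : HasFDerivAt (fun q => L (f q)) (L.comp (fderiv ℝ f p)) p :=
    L.hasFDerivAt.comp p hf.hasFDerivAt
  simp only [dirDeriv, this.fderiv, ContinuousLinearMap.comp_apply]

end Pfaff

/-! ### Matrix coefficients acting on tuples of vectors and on Gram matrices. -/

section MatOp

variable {ι : Type*} [Fintype ι] (V : Type*) [NormedAddCommGroup V] [NormedSpace ℝ V]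

/-- A real matrix acting on tuples of vectors. -/
def matOp : (ι → ι → ℝ) →L[ℝ] (ι → V) →L[ℝ] (ι → V) :=
  LinearMap.toContinuousLinearMap
    { toFun := fun a => ContinuousLinearMap.pi fun i =>
        ∑ j, a i j • ContinuousLinearMap.proj (R := ℝ) (φ := fun _ : ι => V) j
      map_add' := fun a b => by
        ext x i; simp [add_smul, Finset.sum_add_distrib]
      map_smul' := fun c a => by
        ext x i; simp [Finset.smul_sum, mul_smul] }

variable {V}

lemma matOp_apply (a : ι → ι → ℝ) (x : ι → V) (i : ι) : matOp V a x i = ∑ j, a i j • x j := by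
  simp [matOp]

lemma matOp_matOp (a b : ι → ι → ℝ) (x : ι → V) :
    matOp V a (matOp V b x) = matOp V (fun i j => ∑ k, a i k * b k j) x := by
  ext i
  simp only [matOp_apply, Finset.smul_sum, smul_smul, Finset.sum_smul]
  rw [Finset.sum_comm]

lemma hasFDerivAt_matOp_iff {a b : ι → ι → ℝ} {X : ℝ × ℝ → ι → V} {q : ℝ × ℝ} :
    HasFDerivAt X (pfaffForm (matOp V a) (matOp V b) (X q)) q ↔
      ∀ i, DifferentiableAt ℝ (fun p => X p i) q ∧
        du (fun p => X p i) q = ∑ j, a i j • X q j ∧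
        dv (fun p => X p i) q = ∑ j, b i j • X q j := by
  rw [hasFDerivAt_pfaffForm_iff]
  constructor
  · rintro ⟨h, hu, hv⟩ i
    refine ⟨differentiableAt_pi.1 h i, ?_, ?_⟩
    · rw [du, dirDeriv_pi h, ← matOp_apply, ← hu]; rfl
    · rw [dv, dirDeriv_pi h, ← matOp_apply, ← hv]; rfl
  · intro h
    have hd := differentiableAt_pi.2 fun i => (h i).1
    refine ⟨hd, ?_, ?_⟩
    · ext i
      rw [matOp_apply, ← (h i).2.1]
      exact (dirDeriv_pi hd _ i).symm
    · ext i
      rw [matOp_apply, ← (h i).2.2]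
      exact (dirDeriv_pi hd _ i).symm

/-- The derivative `f ↦ a f + f aᵀ` of a Gram matrix along a linear flow with matrix `a`. -/
def gramOp : (ι → ι → ℝ) →L[ℝ] (ι → ι → ℝ) →L[ℝ] (ι → ι → ℝ) :=
  LinearMap.toContinuousLinearMap
    { toFun := fun a => LinearMap.toContinuousLinearMap
        { toFun := fun f i j => (∑ k, a i k * f k j) + ∑ k, a j k * f i k
          map_add' := fun f g => by
            ext i j; simp only [Pi.add_apply, mul_add, Finset.sum_add_distrib]; ring
          map_smul' := fun c f => by
            ext i j
            simp only [Pi.smul_apply, smul_eq_mul, mul_left_comm _ c, ← Finset.mul_sum,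
              RingHom.id_apply, mul_add] }
      map_add' := fun f g => by
        ext h i j
        simp [add_mul, Finset.sum_add_distrib]; ring
      map_smul' := fun c f => by
        ext h i j
        simp [mul_assoc, ← Finset.mul_sum, mul_add] }

lemma gramOp_apply (a f : ι → ι → ℝ) (i j : ι) :
    gramOp a f i j = (∑ k, a i k * f k j) + ∑ k, a j k * f i k := by
  simp [gramOp]

end MatOp

/-! ### The Minkowski product and conservation of Gram matrices. -/

section Inn

lemma inn_comm (x y : E41) : inn x y = inn y x := by simp only [inn]; ring

lemma inn_add_left (x y z : E41) : inn (x + y) z = inn x z + inn y z := by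
  simp only [inn, Pi.add_apply]; ring

lemma inn_add_right (x y z : E41) : inn x (y + z) = inn x y + inn x z := by
  simp only [inn, Pi.add_apply]; ring

lemma inn_sub_left (x y z : E41) : inn (x - y) z = inn x z - inn y z := by
  simp only [inn, Pi.sub_apply]; ring

lemma inn_smul_left (c : ℝ) (x y : E41) : inn (c • x) y = c * inn x y := by
  simp only [inn, Pi.smul_apply, smul_eq_mul]; ring

lemma inn_smul_right (c : ℝ) (x y : E41) : inn x (c • y) = c * inn x y := by
  simp only [inn, Pi.smul_apply, smul_eq_mul]; ring

lemma inn_zero_left (x : E41) : inn 0 x = 0 := by simp [inn]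

lemma inn_sum_left {ι : Type*} (s : Finset ι) (f : ι → E41) (y : E41) :
    inn (∑ i ∈ s, f i) y = ∑ i ∈ s, inn (f i) y :=
  map_sum (AddMonoidHom.mk' (fun x => inn x y) fun a b => inn_add_left a b y) f s

lemma inn_sum_right {ι : Type*} (s : Finset ι) (f : ι → E41) (x : E41) :
    inn x (∑ i ∈ s, f i) = ∑ i ∈ s, inn x (f i) :=
  map_sum (AddMonoidHom.mk' (fun y => inn x y) fun a b => inn_add_right x a b) f s

lemma differentiableAt_inn {f g : ℝ × ℝ → E41} {p : ℝ × ℝ} (hf : DifferentiableAt ℝ f p)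
    (hg : DifferentiableAt ℝ g p) : DifferentiableAt ℝ (fun q => inn (f q) (g q)) p := by
  simp only [inn]
  rw [differentiableAt_pi] at hf hg
  exact ((((hf 0).mul (hg 0)).add ((hf 1).mul (hg 1))).add ((hf 2).mul (hg 2))).sub
    ((hf 3).mul (hg 3))

lemma dirDeriv_inn {f g : ℝ × ℝ → E41} {p : ℝ × ℝ} (hf : DifferentiableAt ℝ f p)
    (hg : DifferentiableAt ℝ g p) (c : ℝ × ℝ) :
    dirDeriv c (fun q => inn (f q) (g q)) p =
      inn (dirDeriv c f p) (g p) + inn (f p) (dirDeriv c g p) := by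
  have h := fun i => (hasFDerivAt_pi'.1 hf.hasFDerivAt i).mul (hasFDerivAt_pi'.1 hg.hasFDerivAt i)
  have h' := (((h 0).add (h 1)).add (h 2)).sub (h 3)
  have e : (fun q => inn (f q) (g q)) =
      (fun q => f q 0) * (fun q => g q 0) + (fun q => f q 1) * (fun q => g q 1) +
        (fun q => f q 2) * (fun q => g q 2) - (fun q => f q 3) * (fun q => g q 3) := rfl
  rw [dirDeriv, e, h'.fderiv]
  simp [inn, dirDeriv]
  ring

/-- The Gram matrix of a solution of a system with coefficients skew with respect to the diagonal
form `η` is constant, if it is `η` at the centre. -/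
theorem gram_eq_of_skew {ι : Type*} [Fintype ι] {a b : ℝ × ℝ → ι → ι → ℝ} {X : ℝ × ℝ → ι → E41}
    {q₀ : ℝ × ℝ} {r : ℝ} {η : ι → ι → ℝ}
    (ha : ContinuousOn a (Metric.ball q₀ r)) (hb : ContinuousOn b (Metric.ball q₀ r))
    (haη : ∀ q, gramOp (a q) η = 0) (hbη : ∀ q, gramOp (b q) η = 0)
    (hX : ∀ q ∈ Metric.ball q₀ r,
      HasFDerivAt X (pfaffForm (matOp E41 (a q)) (matOp E41 (b q)) (X q)) q)
    (h0 : ∀ i j, inn (X q₀ i) (X q₀ j) = η i j) :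
    ∀ q ∈ Metric.ball q₀ r, ∀ i j, inn (X q i) (X q j) = η i j := by
  let f : ℝ × ℝ → ι → ι → ℝ := fun q i j => inn (X q i) (X q j)
  -- Gram matrices evolve by a linear system of which `η` is a stationary solution, skewness being
  -- `gramOp a η = 0`. Hence `f - η` solves the homogeneous system with zero initial value.
  have hf : ∀ q ∈ Metric.ball q₀ r, HasFDerivAt (fun q => f q - η)
      (pfaffForm (gramOp (a q)) (gramOp (b q)) (f q - η)) q := by
    intro q hq
    have hX' := hasFDerivAt_matOp_iff.1 (hX q hq)
    have hfd : DifferentiableAt ℝ f q := by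
      refine differentiableAt_pi.2 fun i => differentiableAt_pi.2 fun j => ?_
      exact differentiableAt_inn (hX' i).1 (hX' j).1
    have key : ∀ (c : ℝ × ℝ) (m : ι → ι → ℝ), gramOp m η = 0 →
        (∀ i, dirDeriv c (fun p => X p i) q = ∑ j, m i j • X q j) →
        dirDeriv c (fun q => f q - η) q = gramOp m (f q - η) := by
      intro c m hm h
      have e : dirDeriv c (fun q => f q - η) q = dirDeriv c f q := by
        simp only [dirDeriv, fderiv_sub_const]
      rw [e, map_sub, hm, sub_zero]
      ext i j
      have hfi := differentiableAt_pi.1 hfd i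
      rw [← dirDeriv_pi hfd, ← dirDeriv_pi hfi, gramOp_apply]
      simp only [f]
      rw [dirDeriv_inn (hX' i).1 (hX' j).1, h, h, inn_sum_left, inn_sum_right]
      simp only [inn_smul_left, inn_smul_right]
    rw [hasFDerivAt_pfaffForm_iff]
    exact ⟨hfd.sub_const _, key _ _ (haη q) fun i => (hX' i).2.1,
      key _ _ (hbη q) fun i => (hX' i).2.2⟩
  have := pfaff_eq_zero_of_continuousOn (gramOp.continuous.comp_continuousOn ha)
    (gramOp.continuous.comp_continuousOn hb) hf (by ext i j; simp [f, h0])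
  intro q hq i j
  have h := congrFun (congrFun (this q hq) i) j
  simpa [f, sub_eq_zero] using h

end Inn

/-! ### Coefficients of the derivation formulas and their integrability. -/

section Coefficients

lemma contDiffOn_dirDeriv {V : Type*} [NormedAddCommGroup V] [NormedSpace ℝ V]
    {f : ℝ × ℝ → V} {U : Set (ℝ × ℝ)} (hU : IsOpen U)
    (hf : ContDiffOn ℝ ∞ f U) (a : ℝ × ℝ) : ContDiffOn ℝ ∞ (dirDeriv a f) U :=
  (hf.fderiv_of_isOpen hU (m := ∞) (by simp)).clm_apply contDiffOn_const

lemma differentiableAt_of_contDiffOn {V : Type*} [NormedAddCommGroup V] [NormedSpace ℝ V]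
    {f : ℝ × ℝ → V} {U : Set (ℝ × ℝ)} (hf : ContDiffOn ℝ ∞ f U) (hU : IsOpen U) {q : ℝ × ℝ}
    (hq : q ∈ U) : DifferentiableAt ℝ f q :=
  (hf.differentiableOn (by simp)).differentiableAt (hU.mem_nhds hq)

/-- The logarithm `ln |μ|`. -/
def logAbs (mu : ℝ × ℝ → ℝ) (q : ℝ × ℝ) : ℝ := Real.log |mu q|

/-- The conformal factor `1 / √|μ|` of canonical parameters. -/
def conf (mu : ℝ × ℝ → ℝ) (q : ℝ × ℝ) : ℝ := Real.exp (-(logAbs mu q / 2))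

lemma conf_pos (mu : ℝ × ℝ → ℝ) (q : ℝ × ℝ) : 0 < conf mu q := Real.exp_pos _

lemma conf_mul_self {mu : ℝ × ℝ → ℝ} {q : ℝ × ℝ} (h : mu q ≠ 0) :
    conf mu q * conf mu q = 1 / |mu q| := by
  rw [conf, ← Real.exp_add, show -(logAbs mu q / 2) + -(logAbs mu q / 2) = -logAbs mu q by ring,
    Real.exp_neg, logAbs, Real.exp_log (abs_pos.2 h), one_div]

lemma conf_mul_self_mul_abs {mu : ℝ × ℝ → ℝ} {q : ℝ × ℝ} (h : mu q ≠ 0) :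
    conf mu q * conf mu q * |mu q| = 1 := by
  rw [conf_mul_self h]
  exact one_div_mul_cancel (abs_ne_zero.2 h)

variable {D : Set (ℝ × ℝ)} {mu : ℝ × ℝ → ℝ}

lemma contDiffOn_logAbs (hmu : ContDiffOn ℝ ∞ mu D) (hmu0 : ∀ p ∈ D, mu p ≠ 0) :
    ContDiffOn ℝ ∞ (logAbs mu) D :=
  (hmu.log hmu0).congr fun _ _ => Real.log_abs _

lemma contDiffOn_conf (hmu : ContDiffOn ℝ ∞ mu D) (hmu0 : ∀ p ∈ D, mu p ≠ 0) :
    ContDiffOn ℝ ∞ (conf mu) D :=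
  ((contDiffOn_logAbs hmu hmu0).div_const 2).neg.exp

/-- Writing the conformal factor as `exp(-ln|μ|/2)` makes its logarithmic derivative immediate and
keeps it positive everywhere, even where `μ` vanishes. -/
lemma dirDeriv_conf {q : ℝ × ℝ} (h : DifferentiableAt ℝ (logAbs mu) q) (c : ℝ × ℝ) :
    dirDeriv c (conf mu) q = -(dirDeriv c (logAbs mu) q / 2) * conf mu q := by
  have h1 : HasFDerivAt (fun q => Real.exp (-(logAbs mu q / 2))) _ q :=
    ((h.hasFDerivAt.mul_const (2 : ℝ)⁻¹).neg).exp
  have h2 : fderiv ℝ (conf mu) q = _ := h1.fderiv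
  rw [dirDeriv, h2]
  simp [dirDeriv, conf]
  ring_nf

lemma dirDeriv_eq_mul_dirDeriv_logAbs {q : ℝ × ℝ} (h : DifferentiableAt ℝ mu q) (h0 : mu q ≠ 0)
    (c : ℝ × ℝ) : dirDeriv c mu q = mu q * dirDeriv c (logAbs mu) q := by
  have e : logAbs mu = fun q => Real.log (mu q) := funext fun _ => Real.log_abs _
  rw [e, dirDeriv, dirDeriv, fderiv.log h h0]
  simp [h0]

/-- The coefficients of the derivation formulas of the geometric frame: the conformal factor,
half the derivative of `ln |μ|` in the direction `c`, and the rescaled geometric functions. -/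
def coefVec (c : ℝ × ℝ) (lam mu nu : ℝ × ℝ → ℝ) (q : ℝ × ℝ) : Fin 5 → ℝ :=
  ![conf mu q, dirDeriv c (logAbs mu) q / 2, lam q * conf mu q, mu q * conf mu q,
    nu q * conf mu q]

/-- The matrix of the derivation formulas of `(z, x, y, b, l)` in the direction `u`. -/
def darbouxA (ε : ℝ) : (Fin 5 → ℝ) →L[ℝ] (Fin 5 → Fin 5 → ℝ) :=
  LinearMap.toContinuousLinearMap
    { toFun := fun w =>
        ![![0, w 0, 0, 0, 0], ![0, 0, w 1, w 4, 0], ![0, -w 1, 0, w 2, w 3],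
          ![0, -(ε * w 4), -(ε * w 2), 0, 0], ![0, 0, ε * w 3, 0, 0]]
      map_add' := fun w w' => by
        ext i j; fin_cases i <;> fin_cases j <;> simp <;> ring_nf
      map_smul' := fun c w => by
        ext i j; fin_cases i <;> fin_cases j <;> simp <;> ring_nf }

/-- The matrix of the derivation formulas of `(z, x, y, b, l)` in the direction `v`. -/
def darbouxB (ε : ℝ) : (Fin 5 → ℝ) →L[ℝ] (Fin 5 → Fin 5 → ℝ) :=
  LinearMap.toContinuousLinearMap
    { toFun := fun w =>
        ![![0, 0, w 0, 0, 0], ![0, 0, -w 1, w 2, w 3], ![0, w 1, 0, w 4, 0],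
          ![0, -(ε * w 2), -(ε * w 4), 0, 0], ![0, ε * w 3, 0, 0, 0]]
      map_add' := fun w w' => by
        ext i j; fin_cases i <;> fin_cases j <;> simp <;> ring_nf
      map_smul' := fun c w => by
        ext i j; fin_cases i <;> fin_cases j <;> simp <;> ring_nf }

lemma darbouxA_apply (ε : ℝ) (w : Fin 5 → ℝ) : darbouxA ε w =
    ![![0, w 0, 0, 0, 0], ![0, 0, w 1, w 4, 0], ![0, -w 1, 0, w 2, w 3],
      ![0, -(ε * w 4), -(ε * w 2), 0, 0], ![0, 0, ε * w 3, 0, 0]] := rfl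

lemma darbouxB_apply (ε : ℝ) (w : Fin 5 → ℝ) : darbouxB ε w =
    ![![0, 0, w 0, 0, 0], ![0, 0, -w 1, w 2, w 3], ![0, w 1, 0, w 4, 0],
      ![0, -(ε * w 2), -(ε * w 4), 0, 0], ![0, ε * w 3, 0, 0, 0]] := rfl

/-- The Gauss–Codazzi equations as the integrability condition of the derivation formulas. -/
lemma darboux_compat (ε k P Q lam mu nu lamu lamv Pv Qu : ℝ)
    (hG : Pv + Qu = ε * (nu ^ 2 - lam ^ 2 + mu ^ 2) * (k * k)) (i j : Fin 5) :
    darbouxA ε ![-P * k, Pv, (lamv - lam * P) * k, mu * P * k,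
        (lamu - 2 * lam * Q - nu * P) * k] i j +
      ∑ n, darbouxA ε ![k, P, lam * k, mu * k, nu * k] i n *
        darbouxB ε ![k, Q, lam * k, mu * k, nu * k] n j =
    darbouxB ε ![-Q * k, Qu, (lamu - lam * Q) * k, mu * Q * k,
        (lamv - 2 * lam * P - nu * Q) * k] i j +
      ∑ n, darbouxB ε ![k, Q, lam * k, mu * k, nu * k] i n *
        darbouxA ε ![k, P, lam * k, mu * k, nu * k] n j := by
  -- `P` and `Q` stand for half of `(ln|μ|)_v` and `(ln|μ|)_u`. The Codazzi equations are already
  -- substituted in the last coefficient on each side, replacing the derivatives of `ν`. Only the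
  -- two entries coupling `x` and `y` involve the Gauss equation, with opposite signs; all others
  -- are identities.
  simp only [darbouxA_apply, darbouxB_apply, Fin.sum_univ_five]
  fin_cases i <;> fin_cases j <;> simp <;>
    first
    | ring1
    | linear_combination hG
    | linear_combination -hG

variable {lam nu : ℝ × ℝ → ℝ}

lemma contDiffOn_coefVec (hD : IsOpen D) (hlam : ContDiffOn ℝ ∞ lam D)
    (hmu : ContDiffOn ℝ ∞ mu D) (hnu : ContDiffOn ℝ ∞ nu D) (hmu0 : ∀ p ∈ D, mu p ≠ 0)
    (c : ℝ × ℝ) : ContDiffOn ℝ ∞ (coefVec c lam mu nu) D := by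
  have hk := contDiffOn_conf hmu hmu0
  rw [contDiffOn_pi]
  intro i
  fin_cases i
  · exact hk
  · exact (contDiffOn_dirDeriv hD (contDiffOn_logAbs hmu hmu0) c).div_const 2
  · exact hlam.mul hk
  · exact hmu.mul hk
  · exact hnu.mul hk

lemma dirDeriv_mul {f g : ℝ × ℝ → ℝ} {p : ℝ × ℝ} (hf : DifferentiableAt ℝ f p)
    (hg : DifferentiableAt ℝ g p) (c : ℝ × ℝ) :
    dirDeriv c (fun q => f q * g q) p = f p * dirDeriv c g p + dirDeriv c f p * g p :=
  dirDeriv_smul hf hg c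

/-- Brings the derivatives of the coefficients into the shape expected by `darboux_compat`: all
derivatives of `k` and `μ` are expressed through those of `ln|μ|`. -/
lemma dirDeriv_coefVec (hD : IsOpen D) (hlam : ContDiffOn ℝ ∞ lam D)
    (hmu : ContDiffOn ℝ ∞ mu D) (hnu : ContDiffOn ℝ ∞ nu D) (hmu0 : ∀ p ∈ D, mu p ≠ 0)
    (c d : ℝ × ℝ) {q : ℝ × ℝ} (hq : q ∈ D) :
    dirDeriv d (coefVec c lam mu nu) q =
      ![-(dirDeriv d (logAbs mu) q / 2) * conf mu q,
        dirDeriv d (dirDeriv c (logAbs mu)) q / 2,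
        (dirDeriv d lam q - lam q * (dirDeriv d (logAbs mu) q / 2)) * conf mu q,
        mu q * (dirDeriv d (logAbs mu) q / 2) * conf mu q,
        (dirDeriv d nu q - nu q * (dirDeriv d (logAbs mu) q / 2)) * conf mu q] := by
  have hv : DifferentiableAt ℝ (coefVec c lam mu nu) q :=
    differentiableAt_of_contDiffOn (contDiffOn_coefVec hD hlam hmu hnu hmu0 c) hD hq
  have hl := differentiableAt_of_contDiffOn (contDiffOn_logAbs hmu hmu0) hD hq
  have hk := differentiableAt_of_contDiffOn (contDiffOn_conf hmu hmu0) hD hq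
  have hm := differentiableAt_of_contDiffOn hmu hD hq
  have hkd := dirDeriv_conf hl d
  ext i
  rw [← dirDeriv_pi hv]
  fin_cases i
  · exact hkd
  · change dirDeriv d (fun q => dirDeriv c (logAbs mu) q / 2) q = _
    have hc := differentiableAt_of_contDiffOn
      (contDiffOn_dirDeriv hD (contDiffOn_logAbs hmu hmu0) c) hD hq
    have := (hc.hasFDerivAt.mul_const (2 : ℝ)⁻¹).fderiv
    simp only [div_eq_mul_inv]
    rw [dirDeriv, this]
    simp [dirDeriv, mul_comm]
  · change dirDeriv d (fun q => lam q * conf mu q) q = _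
    rw [dirDeriv_mul (differentiableAt_of_contDiffOn hlam hD hq) hk, hkd]
    simp; ring
  · change dirDeriv d (fun q => mu q * conf mu q) q = _
    rw [dirDeriv_mul hm hk, hkd, dirDeriv_eq_mul_dirDeriv_logAbs hm (hmu0 q hq)]
    simp; ring
  · change dirDeriv d (fun q => nu q * conf mu q) q = _
    rw [dirDeriv_mul (differentiableAt_of_contDiffOn hnu hD hq) hk, hkd]
    simp; ring

end Coefficients

/-- The derivation formulas for `(z, x, y, b, l)` with coefficients `λ, μ, ν`. -/
def IsDarbouxSol (ε : ℝ) (lam mu nu : ℝ × ℝ → ℝ) (X : ℝ × ℝ → Fin 5 → E41)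
    (S : Set (ℝ × ℝ)) : Prop :=
  ∀ q ∈ S, HasFDerivAt X (pfaffForm (matOp E41 (darbouxA ε (coefVec (0, 1) lam mu nu q)))
    (matOp E41 (darbouxB ε (coefVec (1, 0) lam mu nu q))) (X q)) q

/-! ### Solvability of the derivation formulas. -/

section Existence

variable {ε : ℝ} {D : Set (ℝ × ℝ)} {lam mu nu : ℝ × ℝ → ℝ}

theorem exists_isDarbouxSol (hD : IsOpen D) (hlam : ContDiffOn ℝ ∞ lam D)
    (hmu : ContDiffOn ℝ ∞ mu D) (hnu : ContDiffOn ℝ ∞ nu D) (hmu0 : ∀ p ∈ D, mu p ≠ 0)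
    (h1 : ∀ p ∈ D, du nu p = dv lam p - lam p * dv (logAbs mu) p)
    (h2 : ∀ p ∈ D, dv nu p = du lam p - lam p * du (logAbs mu) p)
    (h3 : ∀ p ∈ D, ε * (nu p ^ 2 - lam p ^ 2 + mu p ^ 2) = 1 / 2 * |mu p| * lap (logAbs mu) p)
    {q₀ : ℝ × ℝ} (hq₀ : q₀ ∈ D) (P : Fin 5 → E41) :
    ∃ r > 0, ∃ X, X q₀ = P ∧ IsDarbouxSol ε lam mu nu X (Metric.ball q₀ r) := by
  -- The `u`-matrix carries the `v`-derivative of `ln|μ|` and conversely: for the metric `k²(du² +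
  -- dv²)` one has `⟨x_u, y⟩ = -k_v/k = (ln|μ|)_v/2`.
  have hA := (((matOp E41 (ι := Fin 5)).comp (darbouxA ε)).contDiff (n := ∞)).comp_contDiffOn
    (contDiffOn_coefVec hD hlam hmu hnu hmu0 (0, 1))
  have hB := (((matOp E41 (ι := Fin 5)).comp (darbouxB ε)).contDiff (n := ∞)).comp_contDiffOn
    (contDiffOn_coefVec hD hlam hmu hnu hmu0 (1, 0))
  refine exists_pfaff_solution hD (hA.of_le (by simp)) (hB.of_le (by simp)) ?_ hq₀ P
  intro q hq x
  have hcA := differentiableAt_of_contDiffOn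
    (contDiffOn_coefVec hD hlam hmu hnu hmu0 (0, 1)) hD hq
  have hcB := differentiableAt_of_contDiffOn
    (contDiffOn_coefVec hD hlam hmu hnu hmu0 (1, 0)) hD hq
  have eA := dirDeriv_clm ((matOp E41 (ι := Fin 5)).comp (darbouxA ε)) hcA (0, 1)
  have eB := dirDeriv_clm ((matOp E41 (ι := Fin 5)).comp (darbouxB ε)) hcB (1, 0)
  rw [dirDeriv_coefVec hD hlam hmu hnu hmu0 _ _ hq] at eA eB
  simp only [Function.comp_def, du, dv]
  rw [eA, eB]
  simp only [ContinuousLinearMap.comp_apply, matOp_matOp]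
  rw [← add_apply, ← add_apply, ← map_add, ← map_add]
  congr 2
  ext i j
  have hk := conf_mul_self_mul_abs (hmu0 q hq)
  -- The prescribed Gauss equation multiplied by `k²`, where `k²|μ| = 1`.
  have hG : dirDeriv (0, 1) (dirDeriv (0, 1) (logAbs mu)) q / 2 +
      dirDeriv (1, 0) (dirDeriv (1, 0) (logAbs mu)) q / 2 =
      ε * (nu q ^ 2 - lam q ^ 2 + mu q ^ 2) * (conf mu q * conf mu q) := by
    rw [h3 q hq]
    simp only [lap, du, dv]
    linear_combination -(dirDeriv (0, 1) (dirDeriv (0, 1) (logAbs mu)) q / 2 +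
      dirDeriv (1, 0) (dirDeriv (1, 0) (logAbs mu)) q / 2) * hk
  have := darboux_compat ε (conf mu q) (dirDeriv (0, 1) (logAbs mu) q / 2)
    (dirDeriv (1, 0) (logAbs mu) q / 2) (lam q) (mu q) (nu q) (dirDeriv (1, 0) lam q)
    (dirDeriv (0, 1) lam q) _ _ hG i j
  -- The two Codazzi equations eliminate the derivatives of `ν`.
  have e1 : dirDeriv (0, 1) nu q =
    dirDeriv (1, 0) lam q - 2 * lam q * (dirDeriv (1, 0) (logAbs mu) q / 2) := by
    rw [show dirDeriv (0, 1) nu q = dv nu q from rfl, h2 q hq]; simp only [du]; ring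
  have e2 : dirDeriv (1, 0) nu q =
    dirDeriv (0, 1) lam q - 2 * lam q * (dirDeriv (0, 1) (logAbs mu) q / 2) := by
    rw [show dirDeriv (1, 0) nu q = du nu q from rfl, h1 q hq]; simp only [dv]; ring
  rw [e1, e2]
  exact this

end Existence

/-! ### The derivation formulas written out, and orthonormality of their solutions. -/

/-- The derivation formulas of `(z, x, y, b, l)` at the point `q`. -/
structure DarbouxEqs (ε : ℝ) (lam mu nu : ℝ × ℝ → ℝ) (z x y b l : ℝ × ℝ → E41)
    (q : ℝ × ℝ) : Prop where
  dz : DifferentiableAt ℝ z q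
  dx : DifferentiableAt ℝ x q
  dy : DifferentiableAt ℝ y q
  db : DifferentiableAt ℝ b q
  dl : DifferentiableAt ℝ l q
  zu : du z q = conf mu q • x q
  zv : dv z q = conf mu q • y q
  xu : du x q = (dv (logAbs mu) q / 2) • y q + (nu q * conf mu q) • b q
  xv : dv x q = -(du (logAbs mu) q / 2) • y q + (lam q * conf mu q) • b q +
    (mu q * conf mu q) • l q
  yu : du y q = -(dv (logAbs mu) q / 2) • x q + (lam q * conf mu q) • b q +
    (mu q * conf mu q) • l q
  yv : dv y q = (du (logAbs mu) q / 2) • x q + (nu q * conf mu q) • b q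
  bu : du b q = -(ε * (nu q * conf mu q)) • x q + -(ε * (lam q * conf mu q)) • y q
  bv : dv b q = -(ε * (lam q * conf mu q)) • x q + -(ε * (nu q * conf mu q)) • y q
  lu : du l q = (ε * (mu q * conf mu q)) • y q
  lv : dv l q = (ε * (mu q * conf mu q)) • x q

section

variable {ε : ℝ} {lam mu nu : ℝ × ℝ → ℝ}

lemma IsDarbouxSol.darbouxEqs {X : ℝ × ℝ → Fin 5 → E41} {S : Set (ℝ × ℝ)}
    (h : IsDarbouxSol ε lam mu nu X S) {q : ℝ × ℝ} (hq : q ∈ S) :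
    DarbouxEqs ε lam mu nu (fun p => X p 0) (fun p => X p 1) (fun p => X p 2) (fun p => X p 3)
      (fun p => X p 4) q := by
  have H := hasFDerivAt_matOp_iff.1 (h q hq)
  simp only [Fin.sum_univ_five, darbouxA_apply, darbouxB_apply, coefVec] at H
  refine ⟨(H 0).1, (H 1).1, (H 2).1, (H 3).1, (H 4).1, ?_, ?_, ?_, ?_, ?_, ?_, ?_, ?_, ?_, ?_⟩
  · simpa using (H 0).2.1
  · simpa using (H 0).2.2
  · simpa [du, dv] using (H 1).2.1
  · simpa [du, dv] using (H 1).2.2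
  · simpa [du, dv] using (H 2).2.1
  · simpa [du, dv] using (H 2).2.2
  · simpa using (H 3).2.1
  · simpa using (H 3).2.2
  · simpa using (H 4).2.1
  · simpa using (H 4).2.2

lemma isDarbouxSol_of_darbouxEqs {z x y b l : ℝ × ℝ → E41} {S : Set (ℝ × ℝ)}
    (h : ∀ q ∈ S, DarbouxEqs ε lam mu nu z x y b l q) :
    IsDarbouxSol ε lam mu nu (fun q => ![z q, x q, y q, b q, l q]) S := by
  intro q hq
  have H := h q hq
  refine hasFDerivAt_matOp_iff.2 fun i => ?_
  simp only [Fin.sum_univ_five, darbouxA_apply, darbouxB_apply, coefVec]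
  fin_cases i
  · exact ⟨H.dz, by simpa using H.zu, by simpa using H.zv⟩
  · exact ⟨H.dx, by simpa [du, dv] using H.xu, by simpa [du, dv] using H.xv⟩
  · exact ⟨H.dy, by simpa [du, dv] using H.yu, by simpa [du, dv] using H.yv⟩
  · exact ⟨H.db, by simpa using H.bu, by simpa using H.bv⟩
  · exact ⟨H.dl, by simpa using H.lu, by simpa using H.lv⟩

/-- Solutions of the derivation formulas starting from an orthonormal frame keep the frame
orthonormal. -/
lemma IsDarbouxSol.isOrthonormalFrame {X : ℝ × ℝ → Fin 5 → E41} {q₀ : ℝ × ℝ} {r : ℝ}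
    (hA : ContinuousOn (coefVec (0, 1) lam mu nu) (Metric.ball q₀ r))
    (hB : ContinuousOn (coefVec (1, 0) lam mu nu) (Metric.ball q₀ r))
    (h : IsDarbouxSol ε lam mu nu X (Metric.ball q₀ r))
    (h0 : IsOrthonormalFrame ε (X q₀ 1) (X q₀ 2) (X q₀ 3) (X q₀ 4)) :
    ∀ q ∈ Metric.ball q₀ r, IsOrthonormalFrame ε (X q 1) (X q 2) (X q 3) (X q 4) := by
  -- Drops the index `0` of the position vector `z`. Its column vanishes in the rows of the frame,
  -- so the frame alone solves a closed system.
  let sub : (Fin 5 → Fin 5 → ℝ) → Fin 4 → Fin 4 → ℝ := fun a i j => a i.succ j.succ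
  have hsub : Continuous sub := by fun_prop
  let η : Fin 4 → Fin 4 → ℝ := ![![1, 0, 0, 0], ![0, 1, 0, 0], ![0, 0, ε, 0], ![0, 0, 0, -ε]]
  have G := gram_eq_of_skew (q₀ := q₀) (r := r) (η := η) (X := fun q i => X q i.succ)
    (a := fun q => sub (darbouxA ε (coefVec (0, 1) lam mu nu q)))
    (b := fun q => sub (darbouxB ε (coefVec (1, 0) lam mu nu q)))
    (hsub.comp_continuousOn ((darbouxA ε).continuous.comp_continuousOn hA))
    (hsub.comp_continuousOn ((darbouxB ε).continuous.comp_continuousOn hB))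
    (fun q => by
      ext i j
      rw [gramOp_apply]
      simp only [sub, darbouxA_apply, Fin.sum_univ_four, η]
      fin_cases i <;> fin_cases j <;> simp <;> ring_nf)
    (fun q => by
      ext i j
      rw [gramOp_apply]
      simp only [sub, darbouxB_apply, Fin.sum_univ_four, η]
      fin_cases i <;> fin_cases j <;> simp <;> ring_nf)
    (fun q hq => by
      refine hasFDerivAt_matOp_iff.2 fun i => ?_
      obtain ⟨d, hu, hv⟩ := hasFDerivAt_matOp_iff.1 (h q hq) i.succ
      refine ⟨d, ?_, ?_⟩
      · rw [hu, Fin.sum_univ_succ]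
        have : darbouxA ε (coefVec (0, 1) lam mu nu q) i.succ 0 = 0 := by
          rw [darbouxA_apply]; fin_cases i <;> rfl
        rw [this, zero_smul, zero_add]
      · rw [hv, Fin.sum_univ_succ]
        have : darbouxB ε (coefVec (1, 0) lam mu nu q) i.succ 0 = 0 := by
          rw [darbouxB_apply]; fin_cases i <;> rfl
        rw [this, zero_smul, zero_add])
    (fun i j => by
      obtain ⟨h1, h2, h3, h4, h5, h6, h7, h8, h9, h10⟩ := h0
      have h5' := (inn_comm _ _).trans h5
      have h6' := (inn_comm _ _).trans h6
      have h7' := (inn_comm _ _).trans h7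
      have h8' := (inn_comm _ _).trans h8
      have h9' := (inn_comm _ _).trans h9
      have h10' := (inn_comm _ _).trans h10
      fin_cases i <;> fin_cases j <;> assumption)
  intro q hq
  have g := G q hq
  exact ⟨g 0 0, g 1 1, g 2 2, g 3 3, g 0 1, g 0 2, g 0 3, g 1 2, g 1 3, g 2 3⟩

end

/-! ### First and second fundamental forms in conformal parameters. -/

section ConformalSurface

variable {z : ℝ × ℝ → E41} {p : ℝ × ℝ} {x y b l : E41} {k ε : ℝ}

lemma coefE_eq (hu : du z p = k • x) (hxx : inn x x = 1) : coefE z p = k * k := by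
  rw [coefE, hu, inn_smul_left, inn_smul_right, hxx, mul_one]

lemma coefG_eq (hv : dv z p = k • y) (hyy : inn y y = 1) : coefG z p = k * k := by
  rw [coefG, hv, inn_smul_left, inn_smul_right, hyy, mul_one]

lemma coefF_eq (hu : du z p = k • x) (hv : dv z p = k • y) (hxy : inn x y = 0) :
    coefF z p = 0 := by
  rw [coefF, hu, hv, inn_smul_left, inn_smul_right, hxy, mul_zero, mul_zero]

lemma normalPart_eq (hk : k ≠ 0) (hu : du z p = k • x) (hv : dv z p = k • y)
    (h : IsOrthonormalFrame ε x y b l) (w : E41) :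
    normalPart z p w = w - inn w x • x - inn w y • y := by
  rw [normalPart, coefE_eq hu h.xx, coefG_eq hv h.yy, coefF_eq hu hv h.xy, hu, hv,
    inn_smul_right, inn_smul_right, smul_smul, smul_smul]
  congr 3
  · field_simp; ring
  · field_simp; ring

lemma normalPart_smul (c : ℝ) (w : E41) : normalPart z p (c • w) = c • normalPart z p w := by
  simp only [normalPart, inn_smul_left, smul_sub, smul_smul]
  congr 3 <;> ring

lemma normalPart_add (w w' : E41) :
    normalPart z p (w + w') = normalPart z p w + normalPart z p w' := by
  simp only [normalPart, inn_add_left]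
  module

/-- The directions `xDir z p`, `yDir z p` are frozen at the point `p`, hence constant as parameter
directions; rescaling therefore produces no derivative of the factors. -/
lemma secondFF_smul (s t : ℝ) (a c : ℝ × ℝ) :
    secondFF z p (s • a) (t • c) = (s * t) • secondFF z p a c := by
  have e : dirDeriv (t • c) z = fun q => t • dirDeriv c z q := by
    funext q; simp [dirDeriv]
  have e' : dirDeriv (s • a) (fun q => t • dirDeriv c z q) p =
      (s * t) • dirDeriv a (dirDeriv c z) p := by
    simp only [dirDeriv, map_smul]
    rw [show (fun q => t • (fderiv ℝ z q) c) = t • (fun q => fderiv ℝ z q c) from rfl,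
      fderiv_const_smul_field]
    simp [smul_smul]
    rfl
  rw [secondFF, e, e', normalPart_smul, secondFF]

lemma xDir_eq (hk : 0 < k) (hE : coefE z p = k * k) : xDir z p = k⁻¹ • ((1, 0) : ℝ × ℝ) := by
  rw [xDir, hE, Real.sqrt_mul_self hk.le]; simp

lemma yDir_eq (hk : 0 < k) (hG : coefG z p = k * k) : yDir z p = k⁻¹ • ((0, 1) : ℝ × ℝ) := by
  rw [yDir, hG, Real.sqrt_mul_self hk.le]; simp

lemma meanCurv_eq (hk : k ≠ 0) (hE : coefE z p = k * k) (hF : coefF z p = 0)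
    (hG : coefG z p = k * k) {n : ℝ} (huu : secondFF z p (1, 0) (1, 0) = (k * k * n) • b)
    (hvv : secondFF z p (0, 1) (0, 1) = (k * k * n) • b) : meanCurv z p = n • b := by
  rw [meanCurv, hE, hF, hG, huu, hvv]
  simp only [mul_zero, zero_smul, sub_zero, smul_smul, ← add_smul]
  congr 1
  field_simp
  ring

end ConformalSurface

/-! ### Solutions of the derivation formulas have the prescribed geometry. -/

section Verification

variable {ε : ℝ} {lam mu nu : ℝ × ℝ → ℝ} {z x y b l : ℝ × ℝ → E41} {S : Set (ℝ × ℝ)}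

/-- Differentiating `z_u = k x` and `z_v = k y`, the terms with derivatives of `k` are tangential
and drop out; what remains is `k` times the normal part of the frame derivative, which carries a
second factor `k`. -/
lemma DarbouxEqs.secondFF_coord (hS : IsOpen S)
    (h : ∀ q ∈ S, DarbouxEqs ε lam mu nu z x y b l q)
    (hf : ∀ q ∈ S, IsOrthonormalFrame ε (x q) (y q) (b q) (l q))
    (hl : ∀ q ∈ S, DifferentiableAt ℝ (conf mu) q) {q : ℝ × ℝ} (hq : q ∈ S) :
    secondFF z q (1, 0) (1, 0) = (conf mu q * conf mu q * nu q) • b q ∧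
    secondFF z q (1, 0) (0, 1) = (conf mu q * conf mu q) • (lam q • b q + mu q • l q) ∧
    secondFF z q (0, 1) (0, 1) = (conf mu q * conf mu q * nu q) • b q := by
  have H := h q hq
  have f := hf q hq
  have hS' := hS.mem_nhds hq
  have eu : dirDeriv (1, 0) z =ᶠ[𝓝 q] fun p => conf mu p • x p := by
    filter_upwards [hS'] with p hp using (h p hp).zu
  have ev : dirDeriv (0, 1) z =ᶠ[𝓝 q] fun p => conf mu p • y p := by
    filter_upwards [hS'] with p hp using (h p hp).zv
  have xu : dirDeriv (1, 0) x q = _ := H.xu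
  have yu : dirDeriv (1, 0) y q = _ := H.yu
  have yv : dirDeriv (0, 1) y q = _ := H.yv
  have hyx := (inn_comm _ _).trans f.xy
  have hbx := (inn_comm _ _).trans f.xb
  have hlx := (inn_comm _ _).trans f.xl
  have hby := (inn_comm _ _).trans f.yb
  have hly := (inn_comm _ _).trans f.yl
  refine ⟨?_, ?_, ?_⟩
  · rw [secondFF, normalPart_eq (conf_pos mu q).ne' H.zu H.zv f, dirDeriv_congr eu,
      dirDeriv_smul (hl q hq) H.dx, xu]
    simp only [inn_add_left, inn_smul_left, f.xx, f.yy, f.xy, hyx, hbx, hby]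
    module
  · rw [secondFF, normalPart_eq (conf_pos mu q).ne' H.zu H.zv f, dirDeriv_congr ev,
      dirDeriv_smul (hl q hq) H.dy, yu]
    simp only [inn_add_left, inn_smul_left, f.xx, f.yy, f.xy, hyx, hbx, hby, hlx, hly]
    module
  · rw [secondFF, normalPart_eq (conf_pos mu q).ne' H.zu H.zv f, dirDeriv_congr ev,
      dirDeriv_smul (hl q hq) H.dy, yv]
    simp only [inn_add_left, inn_smul_left, f.xx, f.yy, f.xy, hyx, hbx, hby]
    module

end Verification

section Verification

variable {ε : ℝ} {lam mu nu : ℝ × ℝ → ℝ} {z x y b l : ℝ × ℝ → E41} {S : Set (ℝ × ℝ)}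

/-- Orthonormal solutions of the derivation formulas are surfaces with the prescribed
geometric data. -/
theorem isSurfaceWithData_of_darbouxEqs (hε : ε = 1 ∨ ε = -1) (hS : IsOpen S)
    (h : ∀ q ∈ S, DarbouxEqs ε lam mu nu z x y b l q)
    (hf : ∀ q ∈ S, IsOrthonormalFrame ε (x q) (y q) (b q) (l q))
    (hk : ∀ q ∈ S, DifferentiableAt ℝ (conf mu) q)
    (hz : ContDiffOn ℝ ∞ z S) (hb : ContDiffOn ℝ ∞ b S) (hl : ContDiffOn ℝ ∞ l S)
    {s : ℝ} (hs : s = 1 ∨ s = -1) (hsν : ∀ q ∈ S, 0 < s * nu q) (q₀ : ℝ × ℝ) :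
    IsSurfaceWithData ε lam mu nu S q₀ (z q₀) ((conf mu q₀)⁻¹ • du z q₀)
      ((conf mu q₀)⁻¹ • dv z q₀) (b q₀) (l q₀) z ∧
    ∀ q ∈ S, meanCurv z q = nu q • b q := by
  have k0 := fun q => (conf_pos mu q).ne'
  have hE : ∀ q ∈ S, coefE z q = conf mu q * conf mu q := fun q hq =>
    coefE_eq (h q hq).zu (hf q hq).xx
  have hF : ∀ q ∈ S, coefF z q = 0 := fun q hq =>
    coefF_eq (h q hq).zu (h q hq).zv (hf q hq).xy
  have hG : ∀ q ∈ S, coefG z q = conf mu q * conf mu q := fun q hq =>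
    coefG_eq (h q hq).zv (hf q hq).yy
  have hX := fun q hq => xDir_eq (conf_pos mu q) (hE q hq)
  have hY := fun q hq => yDir_eq (conf_pos mu q) (hG q hq)
  have hσ := fun q hq => DarbouxEqs.secondFF_coord hS h hf hk (q := q) hq
  have hH : ∀ q ∈ S, meanCurv z q = nu q • b q := fun q hq =>
    meanCurv_eq (k0 q) (hE q hq) (hF q hq) (hG q hq) (hσ q hq).1 (hσ q hq).2.2
  have hxx : ∀ q ∈ S, secondFF z q (xDir z q) (xDir z q) = nu q • b q := fun q hq => by
    have := k0 q
    rw [hX q hq, secondFF_smul, (hσ q hq).1, smul_smul]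
    congr 1; field_simp
  have hyy : ∀ q ∈ S, secondFF z q (yDir z q) (yDir z q) = nu q • b q := fun q hq => by
    have := k0 q
    rw [hY q hq, secondFF_smul, (hσ q hq).2.2, smul_smul]
    congr 1; field_simp
  have hxy : ∀ q ∈ S, secondFF z q (xDir z q) (yDir z q) = lam q • b q + mu q • l q :=
    fun q hq => by
      have := k0 q
      rw [hX q hq, hY q hq, secondFF_smul, (hσ q hq).2.1, smul_smul]
      convert one_smul ℝ _ using 2
      field_simp
  have hν : ∀ q ∈ S, nu q ≠ 0 := fun q hq h0 => by simpa [h0] using hsν q hq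
  have hb0 : ∀ q ∈ S, b q ≠ 0 := fun q hq h0 => by
    have := (hf q hq).bb
    rw [h0, inn_zero_left] at this
    rcases hε with e | e <;> rw [e] at this <;> norm_num at this
  have hss : s * s = 1 := by rcases hs with e | e <;> rw [e] <;> norm_num
  -- The normalized mean curvature field is `s • b` with `s` the sign of `ν`, because `H = ν b = (s
  -- ν)(s b)` must have a positive factor. It is parallel since the derivatives of `b` are
  -- tangential.
  refine ⟨⟨⟨hz, ?_⟩, ⟨fun q hq => ?_, fun q => s • b q, ⟨?_, ?_, ?_⟩, ?_, ?_⟩, rfl, ?_⟩, hH⟩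
  · intro q hq a ha
    rw [dirDeriv_eq, (h q hq).zu, (h q hq).zv]
    have hyx := (inn_comm _ _).trans (hf q hq).xy
    simp only [inn_add_left, inn_add_right, inn_smul_left, inn_smul_right, (hf q hq).xx,
      (hf q hq).yy, (hf q hq).xy, hyx]
    have : 0 < a.1 ^ 2 + a.2 ^ 2 := by
      by_contra hn
      have h1 : a.1 = 0 := by nlinarith [sq_nonneg a.1, sq_nonneg a.2]
      have h2 : a.2 = 0 := by nlinarith [sq_nonneg a.1, sq_nonneg a.2]
      exact ha (Prod.ext h1 h2)
    have hkk := mul_pos (mul_pos (conf_pos mu q) (conf_pos mu q)) this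
    linarith
  · rw [hH q hq]
    exact smul_ne_zero (hν q hq) (hb0 q hq)
  · exact hb.const_smul s
  · intro q hq
    rw [(h q hq).zu, (h q hq).zv]
    have hbx := (inn_comm _ _).trans (hf q hq).xb
    have hby := (inn_comm _ _).trans (hf q hq).yb
    simp [inn_smul_left, inn_smul_right, hbx, hby]
  · intro q hq a
    have hyx := (inn_comm _ _).trans (hf q hq).xy
    rw [dirDeriv_smul (differentiableAt_const s) (h q hq).db, dirDeriv_eq (f := b),
      (h q hq).bu, (h q hq).bv, normalPart_eq (k0 q) (h q hq).zu (h q hq).zv (hf q hq)]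
    simp only [dirDeriv, fderiv_fun_const, Pi.zero_apply, zero_apply, zero_smul, add_zero,
      inn_smul_left, inn_add_left, (hf q hq).xx, (hf q hq).xy, (hf q hq).yy, hyx]
    module
  · intro q hq
    rw [inn_smul_left, inn_smul_right, ← mul_assoc, hss, one_mul, (hf q hq).bb]
    rcases hε with e | e <;> simp [e]
  · intro q hq
    refine ⟨s * nu q, hsν q hq, ?_⟩
    change meanCurv z q = (s * nu q) • s • b q
    rw [hH q hq, smul_smul, mul_right_comm, hss, one_mul]
  · have ex : ∀ q ∈ S, x q = dirDeriv (xDir z q) z q := fun q hq => by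
      rw [hX q hq, dirDeriv_eq, (h q hq).zu]
      simp [smul_smul, k0 q]
    have ey : ∀ q ∈ S, y q = dirDeriv (yDir z q) z q := fun q hq => by
      rw [hY q hq, dirDeriv_eq, (h q hq).zv]
      simp [smul_smul, k0 q]
    refine ⟨fun q => (conf mu q)⁻¹ • du z q, fun q => (conf mu q)⁻¹ • dv z q, b, l,
      ⟨hb, hl, ?_, ?_, ?_, ?_, ?_⟩, ⟨hxx, hyy, hxy⟩, rfl, rfl, rfl, rfl⟩
    · intro q hq
      have := hf q hq
      rw [(h q hq).zu, (h q hq).zv, inv_smul_smul₀ (k0 q), inv_smul_smul₀ (k0 q)]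
      exact this
    · intro q hq
      rw [← ex q hq, (h q hq).zu, inv_smul_smul₀ (k0 q)]
    · intro q hq
      rw [← ey q hq, (h q hq).zv, inv_smul_smul₀ (k0 q)]
    · intro q hq hli
      rw [hxx q hq, hyy q hq] at hli
      exact absurd (hli.injective (a₁ := 0) (a₂ := 1) rfl) (by decide)
    · exact fun q hq => ⟨nu q, hH q hq⟩

end Verification

/-! ### Every surface with the given data satisfies the derivation formulas. -/

section Uniqueness

variable {ε : ℝ}

/-- Nondegeneracy through determinants: with the frame as rows of `M`, orthonormality reads `M J Mᵀ
= η` with `det η ≠ 0`. So `M J` is invertible, and `M J v` lists the products of `v` with the frame.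
-/
lemma IsOrthonormalFrame.eq_zero {x y b l v : E41} (hε : ε ≠ 0)
    (h : IsOrthonormalFrame ε x y b l) (hx : inn x v = 0) (hy : inn y v = 0) (hb : inn b v = 0)
    (hl : inn l v = 0) : v = 0 := by
  let e₄ : Fin 4 → E41 := ![x, y, b, l]
  let M : Matrix (Fin 4) (Fin 4) ℝ := Matrix.of e₄
  let J : Matrix (Fin 4) (Fin 4) ℝ := Matrix.diagonal ![1, 1, 1, -1]
  let η : Matrix (Fin 4) (Fin 4) ℝ := Matrix.diagonal ![1, 1, ε, -ε]
  have inn_eq : ∀ a c : E41, a ⬝ᵥ J.mulVec c = inn a c := by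
    intro a c
    simp [J, inn, dotProduct, Fin.sum_univ_four, Matrix.mulVec_diagonal]
    ring
  have hyx := (inn_comm _ _).trans h.xy
  have hbx := (inn_comm _ _).trans h.xb
  have hlx := (inn_comm _ _).trans h.xl
  have hby := (inn_comm _ _).trans h.yb
  have hly := (inn_comm _ _).trans h.yl
  have hlb := (inn_comm _ _).trans h.bl
  have hM : M * (J * M.transpose) = η := by
    ext i j
    have e : (M * (J * M.transpose)) i j = inn (e₄ i) (e₄ j) := by
      rw [← inn_eq]; rfl
    rw [e]
    fin_cases i <;> fin_cases j <;>
      simp [e₄, η, h.xx, h.yy, h.bb, h.ll, h.xy, h.xb, h.xl, h.yb, h.yl, h.bl, hyx, hbx, hlx, hby,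
        hly, hlb]
  have hdet : M.det * J.det ≠ 0 := by
    have : M.det * (J.det * M.det) = η.det := by
      rw [← hM, Matrix.det_mul, Matrix.det_mul, Matrix.det_transpose]
    have hη : η.det ≠ 0 := by
      simp [η, Matrix.det_diagonal, Fin.prod_univ_four, hε]
    intro h0
    apply hη
    rw [← this, ← mul_assoc, h0, zero_mul]
  have hv : (M * J).mulVec v = 0 := by
    rw [← Matrix.mulVec_mulVec]
    ext i
    have e : (M.mulVec (J.mulVec v)) i = inn (e₄ i) v := by
      rw [← inn_eq]; rfl
    rw [e]
    fin_cases i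
    · exact hx
    · exact hy
    · exact hb
    · exact hl
  exact Matrix.eq_zero_of_mulVec_eq_zero (by rwa [Matrix.det_mul]) hv

end Uniqueness

section Uniqueness

variable {ε : ℝ} {lam mu nu : ℝ × ℝ → ℝ} {w x y b l : ℝ × ℝ → E41} {S : Set (ℝ × ℝ)}

lemma dirDeriv_comm {V : Type*} [NormedAddCommGroup V] [NormedSpace ℝ V] {f : ℝ × ℝ → V}
    (hS : IsOpen S) (hf : ContDiffOn ℝ ∞ f S) {q : ℝ × ℝ} (hq : q ∈ S) (a c : ℝ × ℝ) :
    dirDeriv a (dirDeriv c f) q = dirDeriv c (dirDeriv a f) q := by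
  have hfq : ContDiffAt ℝ ∞ f q := hf.contDiffAt (hS.mem_nhds hq)
  have hd : DifferentiableAt ℝ (fderiv ℝ f) q :=
    differentiableAt_of_contDiffOn (hf.fderiv_of_isOpen hS (m := ∞) (by simp)) hS hq
  have e : ∀ a c : ℝ × ℝ, dirDeriv a (dirDeriv c f) q = fderiv ℝ (fderiv ℝ f) q a c := by
    intro a c
    have : HasFDerivAt (dirDeriv c f) _ q := hd.hasFDerivAt.clm_apply (hasFDerivAt_const c q)
    rw [dirDeriv, this.fderiv]
    simp
  rw [e, e]
  exact (hfq.isSymmSndFDerivAt (by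
    rw [minSmoothness_of_isRCLikeNormedField]
    exact WithTop.coe_le_coe.2 (le_top (a := (2 : ℕ∞))))).eq a c

/-- The expansion of a vector in an orthonormal frame. -/
lemma IsOrthonormalFrame.expansion {x y b l v : E41} (hε : ε = 1 ∨ ε = -1)
    (h : IsOrthonormalFrame ε x y b l) :
    v = inn x v • x + inn y v • y + (ε * inn b v) • b - (ε * inn l v) • l := by
  have hε0 : ε ≠ 0 := by rcases hε with e | e <;> rw [e] <;> norm_num
  have hεε : ε * ε = 1 := by rcases hε with e | e <;> rw [e] <;> norm_num
  have hyx := (inn_comm _ _).trans h.xy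
  have hbx := (inn_comm _ _).trans h.xb
  have hlx := (inn_comm _ _).trans h.xl
  have hby := (inn_comm _ _).trans h.yb
  have hly := (inn_comm _ _).trans h.yl
  have hlb := (inn_comm _ _).trans h.bl
  have hsub : ∀ a c d : E41, inn a (c - d) = inn a c - inn a d := fun a c d => by
    rw [inn_comm, inn_sub_left, inn_comm c, inn_comm d]
  rw [← sub_eq_zero]
  apply h.eq_zero hε0 <;>
    simp only [hsub, inn_add_right, inn_smul_right, h.xx, h.yy, h.bb, h.ll, h.xy, h.xb, h.xl,
      h.yb, h.yl, h.bl, hyx, hbx, hlx, hby, hly, hlb]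
  · ring
  · ring
  · linear_combination -inn b v * hεε
  · linear_combination -inn l v * hεε

/-- The product rule for a constant product; applied to the frame it gives the skew symmetry of the
structure equations. -/
lemma inn_dirDeriv_eq_neg {f g : ℝ × ℝ → E41} {c : ℝ} (hS : IsOpen S)
    (h : ∀ q ∈ S, inn (f q) (g q) = c) {q : ℝ × ℝ} (hq : q ∈ S) (hf : DifferentiableAt ℝ f q)
    (hg : DifferentiableAt ℝ g q) (a : ℝ × ℝ) :
    inn (f q) (dirDeriv a g q) = -inn (g q) (dirDeriv a f q) := by
  have e : (fun q => inn (f q) (g q)) =ᶠ[𝓝 q] fun _ => c := by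
    filter_upwards [hS.mem_nhds hq] with p hp using h p hp
  have h1 := dirDeriv_congr e a
  rw [dirDeriv_inn hf hg] at h1
  have h2 : dirDeriv a (fun _ : ℝ × ℝ => c) q = 0 := by simp [dirDeriv]
  rw [h2] at h1
  rw [inn_comm (g q)]
  linarith

/-- The geometric frame of a surface with parallel normalized mean curvature vector field in
canonical parameters satisfies the derivation formulas. -/
theorem darbouxEqs_of_isGeometricFrame (hε : ε = 1 ∨ ε = -1) (hS : IsOpen S)
    (hmu : ContDiffOn ℝ ∞ mu S) (hmu0 : ∀ p ∈ S, mu p ≠ 0)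
    {s : ℝ} (hs : s = 1 ∨ s = -1) (hsν : ∀ q ∈ S, 0 < s * nu q)
    (hw : IsSpacelikeSurface w S) (hp : HasParallelNormalizedMeanCurv w S)
    (hg : IsGeometricFrame ε w S x y b l) (hd : HasGeometricFunctions w S b l nu nu lam mu)
    (hc : IsCanonical w S mu) :
    ∀ q ∈ S, DarbouxEqs ε lam mu nu w x y b l q := by
  have k0 := fun q => (conf_pos mu q).ne'
  have hE : ∀ q ∈ S, coefE w q = conf mu q * conf mu q := fun q hq => by
    rw [(hc q hq).1, conf_mul_self (hmu0 q hq)]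
  have hF : ∀ q ∈ S, coefF w q = 0 := fun q hq => (hc q hq).2.1
  have hG : ∀ q ∈ S, coefG w q = conf mu q * conf mu q := fun q hq => by
    rw [(hc q hq).2.2, conf_mul_self (hmu0 q hq)]
  have hX := fun q hq => xDir_eq (conf_pos mu q) (hE q hq)
  have hY := fun q hq => yDir_eq (conf_pos mu q) (hG q hq)
  have hwu : ∀ q ∈ S, du w q = conf mu q • x q := fun q hq => by
    rw [hg.x_eq q hq, hX q hq, dirDeriv_eq]
    simp [smul_smul, k0 q]
  have hwv : ∀ q ∈ S, dv w q = conf mu q • y q := fun q hq => by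
    rw [hg.y_eq q hq, hY q hq, dirDeriv_eq]
    simp [smul_smul, k0 q]
  have hk := contDiffOn_conf hmu hmu0
  have hlog := contDiffOn_logAbs hmu hmu0
  have hkd : ∀ q ∈ S, ∀ c, dirDeriv c (conf mu) q = -(dirDeriv c (logAbs mu) q / 2) * conf mu q :=
    fun q hq c => dirDeriv_conf (differentiableAt_of_contDiffOn hlog hS hq) c
  have hkD : ∀ q ∈ S, DifferentiableAt ℝ (conf mu) q := fun q hq =>
    differentiableAt_of_contDiffOn hk hS hq
  have hx : ContDiffOn ℝ ∞ x S := by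
    refine ((hk.inv fun q _ => k0 q).smul (contDiffOn_dirDeriv hS hw.smooth (1, 0))).congr ?_
    intro q hq
    have : dirDeriv (1, 0) w q = _ := hwu q hq
    change x q = (conf mu q)⁻¹ • dirDeriv (1, 0) w q
    rw [this, inv_smul_smul₀ (k0 q)]
  have hy : ContDiffOn ℝ ∞ y S := by
    refine ((hk.inv fun q _ => k0 q).smul (contDiffOn_dirDeriv hS hw.smooth (0, 1))).congr ?_
    intro q hq
    have : dirDeriv (0, 1) w q = _ := hwv q hq
    change y q = (conf mu q)⁻¹ • dirDeriv (0, 1) w q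
    rw [this, inv_smul_smul₀ (k0 q)]
  have dx := fun q hq => differentiableAt_of_contDiffOn hx hS (q := q) hq
  have dy := fun q hq => differentiableAt_of_contDiffOn hy hS (q := q) hq
  have db := fun q hq => differentiableAt_of_contDiffOn hg.smooth_b hS (q := q) hq
  have dl := fun q hq => differentiableAt_of_contDiffOn hg.smooth_l hS (q := q) hq
  have hf := hg.orthonormal
  have duw : ∀ q ∈ S, ∀ a, dirDeriv a (dirDeriv (1, 0) w) q =
      conf mu q • (dirDeriv a x q - (dirDeriv a (logAbs mu) q / 2) • x q) := by
    intro q hq a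
    have e : dirDeriv (1, 0) w =ᶠ[𝓝 q] fun p => conf mu p • x p := by
      filter_upwards [hS.mem_nhds hq] with p hp using hwu p hp
    rw [dirDeriv_congr e, dirDeriv_smul (hkD q hq) (dx q hq), hkd q hq]
    module
  have dvw : ∀ q ∈ S, ∀ a, dirDeriv a (dirDeriv (0, 1) w) q =
      conf mu q • (dirDeriv a y q - (dirDeriv a (logAbs mu) q / 2) • y q) := by
    intro q hq a
    have e : dirDeriv (0, 1) w =ᶠ[𝓝 q] fun p => conf mu p • y p := by
      filter_upwards [hS.mem_nhds hq] with p hp using hwv p hp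
    rw [dirDeriv_congr e, dirDeriv_smul (hkD q hq) (dy q hq), hkd q hq]
    module
  -- Equality of the mixed derivatives `w_uv = w_vu`, divided by `k`. Its `x`- and `y`-components
  -- determine the tangential coefficients of the frame derivatives.
  have hsymm : ∀ q ∈ S, dv x q - (dv (logAbs mu) q / 2) • x q =
      du y q - (du (logAbs mu) q / 2) • y q := by
    intro q hq
    have h1 := dirDeriv_comm hS hw.smooth hq (0, 1) (1, 0)
    rw [duw q hq, dvw q hq] at h1
    exact smul_right_injective _ (k0 q) h1
  -- the second fundamental form in the coordinate directions
  have hσ : ∀ q ∈ S,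
      secondFF w q (1, 0) (1, 0) = (conf mu q * conf mu q * nu q) • b q ∧
      secondFF w q (1, 0) (0, 1) =
        (conf mu q * conf mu q) • (lam q • b q + mu q • l q) ∧
      secondFF w q (0, 1) (0, 1) = (conf mu q * conf mu q * nu q) • b q := by
    intro q hq
    have h1 := hd.xx q hq
    have h2 := hd.xy q hq
    have h3 := hd.yy q hq
    rw [hX q hq, secondFF_smul] at h1
    rw [hX q hq, hY q hq, secondFF_smul] at h2
    rw [hY q hq, secondFF_smul] at h3
    have hinv : conf mu q * conf mu q * ((conf mu q)⁻¹ * (conf mu q)⁻¹) = 1 := by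
      have := k0 q; field_simp
    refine ⟨?_, ?_, ?_⟩
    · rw [mul_smul, ← h1, smul_smul, hinv, one_smul]
    · rw [← h2, smul_smul, hinv, one_smul]
    · rw [mul_smul, ← h3, smul_smul, hinv, one_smul]
  have hN := fun q hq => normalPart_eq (k0 q) (hwu q hq) (hwv q hq) (hf q hq)
  have hH : ∀ q ∈ S, meanCurv w q = nu q • b q := fun q hq =>
    meanCurv_eq (k0 q) (hE q hq) (hF q hq) (hG q hq) (hσ q hq).1 (hσ q hq).2.2
  have hN0x : ∀ q ∈ S, normalPart w q (x q) = 0 := fun q hq => by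
    rw [hN q hq, (hf q hq).xx, (hf q hq).xy]; simp
  have hN0y : ∀ q ∈ S, normalPart w q (y q) = 0 := fun q hq => by
    rw [hN q hq, (hf q hq).yy, inn_comm, (hf q hq).xy]; simp
  have dec : ∀ q ∈ S, ∀ v, v = inn (x q) v • x q + inn (y q) v • y q + normalPart w q v :=
    fun q hq v => by
      rw [hN q hq, inn_comm v, inn_comm v]; abel
  have nx : ∀ q ∈ S, ∀ a, normalPart w q (dirDeriv a x q) =
      (conf mu q)⁻¹ • secondFF w q a (1, 0) := by
    intro q hq a
    rw [secondFF, duw q hq, normalPart_smul, inv_smul_smul₀ (k0 q), sub_eq_add_neg, ← neg_smul,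
      normalPart_add, normalPart_smul, hN0x q hq, smul_zero, add_zero]
  have ny : ∀ q ∈ S, ∀ a, normalPart w q (dirDeriv a y q) =
      (conf mu q)⁻¹ • secondFF w q a (0, 1) := by
    intro q hq a
    rw [secondFF, dvw q hq, normalPart_smul, inv_smul_smul₀ (k0 q), sub_eq_add_neg, ← neg_smul,
      normalPart_add, normalPart_smul, hN0y q hq, smul_zero, add_zero]
  have hss : s * s = 1 := by rcases hs with e | e <;> rw [e] <;> norm_num
  obtain ⟨-, ξ, hξ, hξ1, hξH⟩ := hp
  -- Both `ν b` and `h ξ` equal `H`. Comparing absolute squares gives `ν² = h²`, and positivity of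
  -- `h` and `s ν` selects `h = s ν`. Thus `b` is a constant multiple of the parallel field.
  have hbξ : ∀ q ∈ S, b q = s • ξ q := by
    intro q hq
    obtain ⟨h, hh, hHh⟩ := hξH q hq
    rw [hH q hq] at hHh
    have e1 : nu q * (nu q * ε) = h * (h * inn (ξ q) (ξ q)) := by
      have : inn (nu q • b q) (nu q • b q) = inn (h • ξ q) (h • ξ q) := by rw [hHh]
      simpa only [inn_smul_left, inn_smul_right, (hf q hq).bb] using this
    have e2 : nu q * nu q = h * h := by
      have hε1 : |ε| = 1 := by rcases hε with e | e <;> simp [e]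
      have := congrArg abs e1
      rw [← mul_assoc, ← mul_assoc, abs_mul, abs_mul _ (inn _ _), hε1, hξ1 q hq, mul_one, mul_one,
        abs_mul_self, abs_mul_self] at this
      exact this
    have e3 : s * nu q = h := by
      have : (s * nu q - h) * (s * nu q + h) = 0 := by linear_combination nu q ^ 2 * hss + e2
      rcases mul_eq_zero.1 this with e | e
      · linarith
      · linarith [hsν q hq]
    have e4 : nu q • b q = nu q • (s • ξ q) := by
      rw [hHh, ← e3, smul_smul, mul_comm]
    have hν0 : nu q ≠ 0 := fun h0 => by simpa [h0] using hsν q hq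
    exact smul_right_injective _ hν0 e4
  have nb : ∀ q ∈ S, ∀ a, normalPart w q (dirDeriv a b q) = 0 := by
    intro q hq a
    have e : b =ᶠ[𝓝 q] fun p => s • ξ p := by
      filter_upwards [hS.mem_nhds hq] with p hp using hbξ p hp
    rw [dirDeriv_congr e, dirDeriv_smul (differentiableAt_const s)
      (differentiableAt_of_contDiffOn hξ.smooth hS hq)]
    simp only [dirDeriv, fderiv_fun_const, Pi.zero_apply, zero_apply, zero_smul, add_zero]
    rw [normalPart_smul, show normalPart w q (fderiv ℝ ξ q a) = 0 from hξ.parallel q hq a,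
      smul_zero]
  have self0 : ∀ t : ℝ, t = -t → t = 0 := fun t ht => by linarith
  have ixx : ∀ q ∈ S, ∀ a, inn (x q) (dirDeriv a x q) = 0 := fun q hq a =>
    self0 _ (inn_dirDeriv_eq_neg hS (fun q hq => (hf q hq).xx) hq (dx q hq) (dx q hq) a)
  have iyy : ∀ q ∈ S, ∀ a, inn (y q) (dirDeriv a y q) = 0 := fun q hq a =>
    self0 _ (inn_dirDeriv_eq_neg hS (fun q hq => (hf q hq).yy) hq (dy q hq) (dy q hq) a)
  have ill : ∀ q ∈ S, ∀ a, inn (l q) (dirDeriv a l q) = 0 := fun q hq a =>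
    self0 _ (inn_dirDeriv_eq_neg hS (fun q hq => (hf q hq).ll) hq (dl q hq) (dl q hq) a)
  have ixy : ∀ q ∈ S, ∀ a, inn (x q) (dirDeriv a y q) = -inn (y q) (dirDeriv a x q) :=
    fun q hq a => inn_dirDeriv_eq_neg hS (fun q hq => (hf q hq).xy) hq (dx q hq) (dy q hq) a
  have ixb : ∀ q ∈ S, ∀ a, inn (x q) (dirDeriv a b q) = -inn (b q) (dirDeriv a x q) :=
    fun q hq a => inn_dirDeriv_eq_neg hS (fun q hq => (hf q hq).xb) hq (dx q hq) (db q hq) a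
  have iyb : ∀ q ∈ S, ∀ a, inn (y q) (dirDeriv a b q) = -inn (b q) (dirDeriv a y q) :=
    fun q hq a => inn_dirDeriv_eq_neg hS (fun q hq => (hf q hq).yb) hq (dy q hq) (db q hq) a
  have ixl : ∀ q ∈ S, ∀ a, inn (x q) (dirDeriv a l q) = -inn (l q) (dirDeriv a x q) :=
    fun q hq a => inn_dirDeriv_eq_neg hS (fun q hq => (hf q hq).xl) hq (dx q hq) (dl q hq) a
  have iyl : ∀ q ∈ S, ∀ a, inn (y q) (dirDeriv a l q) = -inn (l q) (dirDeriv a y q) :=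
    fun q hq a => inn_dirDeriv_eq_neg hS (fun q hq => (hf q hq).yl) hq (dy q hq) (dl q hq) a
  have ibl : ∀ q ∈ S, ∀ a, inn (b q) (dirDeriv a l q) = -inn (l q) (dirDeriv a b q) :=
    fun q hq a => inn_dirDeriv_eq_neg hS (fun q hq => (hf q hq).bl) hq (db q hq) (dl q hq) a
  intro q hq
  have f := hf q hq
  have hyx := (inn_comm _ _).trans f.xy
  have hbx := (inn_comm _ _).trans f.xb
  have hlx := (inn_comm _ _).trans f.xl
  have hby := (inn_comm _ _).trans f.yb
  have hly := (inn_comm _ _).trans f.yl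
  have hlb := (inn_comm _ _).trans f.bl
  have hsub : ∀ a c d : E41, inn a (c - d) = inn a c - inn a d := fun a c d => by
    rw [inn_comm, inn_sub_left, inn_comm c, inn_comm d]
  obtain ⟨σ1, σ2, σ3⟩ := hσ q hq
  have sx := congrArg (inn (x q)) (hsymm q hq)
  have sy := congrArg (inn (y q)) (hsymm q hq)
  simp only [hsub, inn_smul_right, f.xx, f.yy, f.xy, hyx, dv, du, ixx q hq, iyy q hq,
    ixy q hq] at sx sy
  have xu : du x q = (dv (logAbs mu) q / 2) • y q + (nu q * conf mu q) • b q := by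
    have e := dec q hq (dirDeriv (1, 0) x q)
    rw [nx q hq, ixx q hq, σ1, show inn (y q) (dirDeriv (1, 0) x q) = dv (logAbs mu) q / 2 by
      simp only [dv]; linarith, smul_smul] at e
    rw [du, e]
    have := k0 q
    rw [zero_smul, zero_add]
    congr 2
    field_simp
  have yv : dv y q = (du (logAbs mu) q / 2) • x q + (nu q * conf mu q) • b q := by
    have e := dec q hq (dirDeriv (0, 1) y q)
    rw [ny q hq, iyy q hq, σ3, show inn (x q) (dirDeriv (0, 1) y q) = du (logAbs mu) q / 2 by
      rw [ixy q hq]; simp only [du]; linarith, smul_smul] at e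
    rw [dv, e]
    have := k0 q
    rw [zero_smul, add_zero]
    congr 2
    field_simp
  have yu : du y q = -(dv (logAbs mu) q / 2) • x q + (lam q * conf mu q) • b q +
      (mu q * conf mu q) • l q := by
    have e := dec q hq (dirDeriv (1, 0) y q)
    rw [ny q hq, iyy q hq, σ2, show inn (x q) (dirDeriv (1, 0) y q) = -(dv (logAbs mu) q / 2) by
      rw [ixy q hq]; simp only [dv]; linarith, smul_smul, ← mul_assoc, inv_mul_cancel₀ (k0 q)] at e
    rw [du, e]
    module
  -- Obtained from `hsymm` and `yu`, as the data give the mixed second fundamental form in one order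
  -- of the arguments only.
  have xv : dv x q = -(du (logAbs mu) q / 2) • y q + (lam q * conf mu q) • b q +
      (mu q * conf mu q) • l q := by
    have e := hsymm q hq
    rw [yu, sub_eq_iff_eq_add] at e
    rw [e]
    module
  have xu' : dirDeriv (1, 0) x q = _ := xu
  have xv' : dirDeriv (0, 1) x q = _ := xv
  have yu' : dirDeriv (1, 0) y q = _ := yu
  have yv' : dirDeriv (0, 1) y q = _ := yv
  have bu : du b q = -(ε * (nu q * conf mu q)) • x q + -(ε * (lam q * conf mu q)) • y q := by
    have e := dec q hq (dirDeriv (1, 0) b q)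
    rw [nb q hq, ixb q hq, iyb q hq, xu', yu'] at e
    simp only [inn_add_right, inn_smul_right, hbx, hby, f.bb, f.bl] at e
    rw [du, e]
    module
  have bv : dv b q = -(ε * (lam q * conf mu q)) • x q + -(ε * (nu q * conf mu q)) • y q := by
    have e := dec q hq (dirDeriv (0, 1) b q)
    rw [nb q hq, ixb q hq, iyb q hq, xv', yv'] at e
    simp only [inn_add_right, inn_smul_right, hbx, hby, f.bb, f.bl] at e
    rw [dv, e]
    module
  have bu' : dirDeriv (1, 0) b q = _ := bu
  have bv' : dirDeriv (0, 1) b q = _ := bv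
  have lu : du l q = (ε * (mu q * conf mu q)) • y q := by
    -- The normal components vanish: `⟨l, l⟩` is constant, and `⟨b, l_u⟩ = -⟨l, b_u⟩ = 0` because
    -- `b_u` is tangential.
    have e := f.expansion hε (v := dirDeriv (1, 0) l q)
    rw [ixl q hq, iyl q hq, ibl q hq, ill q hq, xu', yu', bu'] at e
    simp only [inn_add_right, inn_smul_right, hlx, hly, hlb, f.ll] at e
    rw [du, e]
    module
  have lv : dv l q = (ε * (mu q * conf mu q)) • x q := by
    have e := f.expansion hε (v := dirDeriv (0, 1) l q)
    rw [ixl q hq, iyl q hq, ibl q hq, ill q hq, xv', yv', bv'] at e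
    simp only [inn_add_right, inn_smul_right, hlx, hly, hlb, f.ll] at e
    rw [dv, e]
    module
  exact ⟨differentiableAt_of_contDiffOn hw.smooth hS hq, dx q hq, dy q hq, db q hq, dl q hq,
    hwu q hq, hwv q hq, xu, xv, yu, yv, bu, bv, lu, lv⟩

end Uniqueness

/-- Two solutions of the derivation formulas with the same initial value coincide. -/
lemma IsDarbouxSol.eqOn {ε : ℝ} {lam mu nu : ℝ × ℝ → ℝ} {X Y : ℝ × ℝ → Fin 5 → E41}
    {q₀ : ℝ × ℝ} {r : ℝ}
    (hA : ContinuousOn (coefVec (0, 1) lam mu nu) (Metric.ball q₀ r))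
    (hB : ContinuousOn (coefVec (1, 0) lam mu nu) (Metric.ball q₀ r))
    (hX : IsDarbouxSol ε lam mu nu X (Metric.ball q₀ r))
    (hY : IsDarbouxSol ε lam mu nu Y (Metric.ball q₀ r)) (h0 : X q₀ = Y q₀) :
    EqOn X Y (Metric.ball q₀ r) := by
  intro q hq
  refine sub_eq_zero.1 (pfaff_eq_zero_of_continuousOn (X := fun q => X q - Y q)
    ((matOp E41).continuous.comp_continuousOn ((darbouxA ε).continuous.comp_continuousOn hA))
    ((matOp E41).continuous.comp_continuousOn ((darbouxB ε).continuous.comp_continuousOn hB))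
    (fun p hp => ?_) (sub_eq_zero.2 h0) q hq)
  refine ((hX p hp).sub (hY p hp)).congr_fderiv ?_
  ext c <;> simp [pfaffForm_apply]

end Minkowski

end

/-! ### Assembly of existence and uniqueness on a common ball. -/

theorem mainTheorem2 (ε : ℝ) (hε : ε = 1 ∨ ε = -1)
    (D : Set (ℝ × ℝ)) (hDo : IsOpen D) (hDc : IsConnected D)
    (lam mu nu : ℝ × ℝ → ℝ)
    (hlam : ContDiffOn ℝ ∞ lam D) (hmu : ContDiffOn ℝ ∞ mu D) (hnu : ContDiffOn ℝ ∞ nu D)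
    (hmu0 : ∀ p ∈ D, mu p ≠ 0)
    (hnuc : ∃ p ∈ D, ∃ q ∈ D, nu p ≠ nu q)
    (h1 : ∀ p ∈ D, Minkowski.du nu p =
      Minkowski.dv lam p - lam p * Minkowski.dv (fun q => Real.log |mu q|) p)
    (h2 : ∀ p ∈ D, Minkowski.dv nu p =
      Minkowski.du lam p - lam p * Minkowski.du (fun q => Real.log |mu q|) p)
    (h3 : ∀ p ∈ D, ε * (nu p ^ 2 - lam p ^ 2 + mu p ^ 2) =
      1 / 2 * |mu p| * Minkowski.lap (fun q => Real.log |mu q|) p)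
    (q₀ : ℝ × ℝ) (hq₀ : q₀ ∈ D) (hnu0 : nu q₀ ≠ 0)
    (p₀ x₀ y₀ b₀ l₀ : Minkowski.E41)
    (hframe : Minkowski.IsOrthonormalFrame ε x₀ y₀ b₀ l₀) :
    ∃ D₀ : Set (ℝ × ℝ), D₀ ⊆ D ∧ IsOpen D₀ ∧ IsConnected D₀ ∧ q₀ ∈ D₀ ∧
      ∃ z : ℝ × ℝ → Minkowski.E41,
        Minkowski.IsSurfaceWithData ε lam mu nu D₀ q₀ p₀ x₀ y₀ b₀ l₀ z ∧
        (∀ p ∈ D₀,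
          (ε = 1 → 0 < Minkowski.inn (Minkowski.meanCurv z p) (Minkowski.meanCurv z p)) ∧
          (ε = -1 → Minkowski.inn (Minkowski.meanCurv z p) (Minkowski.meanCurv z p) < 0)) ∧
        Minkowski.IsCanonical z D₀ mu ∧
        ∀ w : ℝ × ℝ → Minkowski.E41,
          Minkowski.IsSurfaceWithData ε lam mu nu D₀ q₀ p₀ x₀ y₀ b₀ l₀ w →
          Minkowski.IsCanonical w D₀ mu → Set.EqOn w z D₀ := by
  open Minkowski in
  obtain ⟨r₁, hr₁, X, hX₀, hX⟩ := exists_isDarbouxSol hDo hlam hmu hnu hmu0 h1 h2 h3 hq₀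
    ![p₀, x₀, y₀, b₀, l₀]
  -- `s` is the sign of `ν` at `q₀`; by continuity it persists on a small ball, which keeps `H ≠ 0`
  -- there.
  obtain ⟨s, hs, hsν₀⟩ : ∃ s : ℝ, (s = 1 ∨ s = -1) ∧ 0 < s * nu q₀ := by
    rcases lt_or_gt_of_ne hnu0 with h | h
    · exact ⟨-1, Or.inr rfl, by linarith⟩
    · exact ⟨1, Or.inl rfl, by linarith⟩
  have hev : ∀ᶠ q in nhds q₀, q ∈ D ∧ 0 < s * nu q := by
    refine Filter.Eventually.and (hDo.mem_nhds hq₀) ?_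
    exact (continuousAt_const.mul (hnu.continuousOn.continuousAt (hDo.mem_nhds hq₀))).eventually
      (lt_mem_nhds hsν₀)
  obtain ⟨r₂, hr₂, hball⟩ := Metric.eventually_nhds_iff_ball.1 hev
  let r := min r₁ r₂
  have hr : 0 < r := lt_min hr₁ hr₂
  have hb₁ : Metric.ball q₀ r ⊆ Metric.ball q₀ r₁ := Metric.ball_subset_ball (min_le_left _ _)
  have hb₂ : Metric.ball q₀ r ⊆ Metric.ball q₀ r₂ := Metric.ball_subset_ball (min_le_right _ _)
  have hSD : Metric.ball q₀ r ⊆ D := fun q hq => (hball q (hb₂ hq)).1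
  have hsν : ∀ q ∈ Metric.ball q₀ r, 0 < s * nu q := fun q hq => (hball q (hb₂ hq)).2
  have hSo : IsOpen (Metric.ball q₀ r) := Metric.isOpen_ball
  have hq₀S : q₀ ∈ Metric.ball q₀ r := Metric.mem_ball_self hr
  have hXS : IsDarbouxSol ε lam mu nu X (Metric.ball q₀ r) := fun q hq => hX q (hb₁ hq)
  have hcA := (contDiffOn_coefVec hDo hlam hmu hnu hmu0 (0, 1)).mono hSD
  have hcB := (contDiffOn_coefVec hDo hlam hmu hnu hmu0 (1, 0)).mono hSD
  have hmuS := hmu.mono hSD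
  have hmu0S : ∀ p ∈ Metric.ball q₀ r, mu p ≠ 0 := fun p hp => hmu0 p (hSD hp)
  have hXs : ContDiffOn ℝ ∞ X (Metric.ball q₀ r) := pfaff_contDiffOn hSo
    (((matOp E41 (ι := Fin 5)).comp (darbouxA ε)).contDiff.comp_contDiffOn hcA)
    (((matOp E41 (ι := Fin 5)).comp (darbouxB ε)).contDiff.comp_contDiffOn hcB) hXS
  have hXi := contDiffOn_pi.1 hXs
  have hfr := hXS.isOrthonormalFrame hcA.continuousOn hcB.continuousOn (by
    rw [hX₀]; exact hframe)
  have heqs := fun q hq => hXS.darbouxEqs (q := q) hq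
  have hk0 := (conf_pos mu q₀).ne'
  obtain ⟨hsurf, hH⟩ := isSurfaceWithData_of_darbouxEqs hε hSo heqs hfr
    (fun q hq => differentiableAt_of_contDiffOn (contDiffOn_conf hmuS hmu0S) hSo hq)
    (hXi 0) (hXi 3) (hXi 4) hs hsν q₀
  rw [(heqs q₀ hq₀S).zu, (heqs q₀ hq₀S).zv, inv_smul_smul₀ hk0, inv_smul_smul₀ hk0, hX₀] at hsurf
  refine ⟨Metric.ball q₀ r, hSD, hSo, ⟨⟨q₀, hq₀S⟩, (convex_ball q₀ r).isPreconnected⟩, hq₀S,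
    fun q => X q 0, hsurf, fun q hq => ?_, fun q hq => ?_, fun w hw hwc => ?_⟩
  · have hν : 0 < nu q * nu q :=
      mul_self_pos.2 fun h0 => by simpa [h0] using hsν q hq
    rw [hH q hq, inn_smul_left, inn_smul_right, (hfr q hq).bb, ← mul_assoc]
    constructor
    · rintro rfl; linarith
    · rintro rfl; linarith
  · have h := heqs q hq
    rw [← conf_mul_self (hmu0S q hq)]
    exact ⟨coefE_eq h.zu (hfr q hq).xx, coefF_eq h.zu h.zv (hfr q hq).xy,
      coefG_eq h.zv (hfr q hq).yy⟩
  -- The frame of `w` solves the same system with the same initial value; the component `0` of the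
  -- resulting equality is the position vector.
  · obtain ⟨x, y, b, l, hg, hd, hx₀, hy₀, hb₀, hl₀⟩ := hw.frame
    have hwe := darbouxEqs_of_isGeometricFrame hε hSo hmuS hmu0S hs hsν hw.surface hw.pnmc hg hd hwc
    have := (isDarbouxSol_of_darbouxEqs hwe).eqOn hcA.continuousOn hcB.continuousOn hXS (by
      rw [hX₀]; simp only [hw.passes, hx₀, hy₀, hb₀, hl₀])
    intro q hq
    exact congrFun (this hq) 0
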